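/- **Setting.** Let $\mathcal X$ be a measurable space with a $\sigma$-finite reference measure $dx$ (e.g. a subset of $\mathbb R^d$ with Lebesgue measure). One observes i.i.d. pairs $(X_i,Y_i)_{i=1}^n$ with $$Y_i=\mu(X_i)+\sigma(X_i)\epsilon_i ,$$ where $X_i$ and $\epsilon_i$ are independent, $\epsilon_i$ has a known density $f$ with respect to Lebesgue measure on $\mathbb R$, and $X_i$ has a density $h\in\mathcal H$ with respect to $dx$. The regression function $\mu$ belongs to a class $\mathcal U$ of measurable functions with $\sup_{\mu\in\mathcal U}\|\mu\|_\infty<\infty$; the scale function $\sigma$ belongs to a nonempty class $\Sigma$ of measurable functions with $\overline\sigma^{-1}\le\sigma(x)\le\overline\sigma$ for all $x\in\mathcal X$ and all $\sigma\in\Sigma$, for a fixed $\overline\sigma>1$. Write $\|u-v\|_{2,h}^2=\int(u-v)^2h\,dx$. For a class $V$ of functions and $\varepsilon>0$, let $M_h(\varepsilon;V)\in[0,\infty]$ be its packing entropy, i.e. the logarithm of the supremum of the cardinalities of finite $N\subset V$ with $\|u-v\|_{2,h}>\varepsilon$ for all distinct $u,v\in N$. Let $f_{\eta,\sigma}(y)=\frac1\sigma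 f\big(\frac{y-\eta}{\sigma}\big)$ and let $D(q_1\|q_2)=\int q_1\log\frac{q_1}{q_2}$ be the Kullback–Leibler divergence. **Assumptions.** $D(f_{0,1}\|f_{\eta,\sigma})$ is finite and continuous in $(\eta,\sigma)\in\mathbb R\times(0,\infty)$, and: 1. $D(f_{0,1}\|f_{\eta,\sigma})=O(\eta^2+(1-\sigma)^2)$ for $(\eta,\sigma)$ near $(0,1)$. 2. The family $\{f_{\eta,\sigma}\}$ is Hellinger differentiable at $(0,1)$ with linearly independent derivative components: there are $\dot\xi_1,\dot\xi_2\in L_2(\mathbb R)$, linearly independent in $L_2(\mathbb R)$, such that $\big\|\sqrt{f_{\eta,\sigma}}-\sqrt{f_{0,1}}-\eta\dot\xi_1-(\sigma-1)\dot\xi_2\big\|_{L_2(\mathbb R)}=o\big(\sqrt{\eta^2+(\sigma-1)^2}\big)$ as $(\eta,\sigma)\to(0,1)$. 3. There are $h_0\in\mathcal H$ and $C<\infty$ with $h(x)\le C\,h_0(x)$ for all $x\in\mathcal X$ and all $h\in\mathcal H$. 4. $M_{h_0}(\varepsilon;\mathcal U)$ is of order $M(\varepsilon)$ as $\varepsilon\to0^+$,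 i.e. $M_{h_0}(\varepsilon;\mathcal U)\asymp M(\varepsilon)$ (in particular it is finite), where $M\ge 0$ is rich ($\liminf_{\varepsilon\to0^+}M(\alpha\varepsilon)/M(\varepsilon)>1$ for some $0<\alpha<1$) and order regular ($M(c\varepsilon)\asymp M(\varepsilon)$ as $\varepsilon\to0^+$ for every $c>0$). Moreover $M_{h_0}(\varepsilon;\Sigma)=O(M(\varepsilon))$ as $\varepsilon\to0^+$. **Conclusion.** Let $\varepsilon_n>0$ with $\varepsilon_n\to0$ be determined by $M(\varepsilon_n)=n\varepsilon_n^2$ for all large $n$. Then, as $n\to\infty$, $$\inf_{\hat\mu}\ \sup_{\mu\in\mathcal U,\,\sigma\in\Sigma,\,h\in\mathcal H}\mathbb E\|\mu-\hat\mu\|_{2,h}^2\asymp\varepsilon_n^2 ,$$ where the infimum is over all (measurable) estimators $\hat\mu$ based on the $n$ observations; that is, the ratio of the two sides is bounded between two positive constants for all large $n$. -/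

import Mathlib

open MeasureTheory Filter Topology

noncomputable section

namespace LocScale

/-- `p` is a probability density with respect to `ν`. -/
structure IsDensity {α : Type*} [MeasurableSpace α] (ν : Measure α) (p : α → ℝ) : Prop where
  measurable : Measurable p
  nonneg : ∀ x, 0 ≤ p x
  lintegral_eq_one : ∫⁻ x, ENNReal.ofReal (p x) ∂ν = 1

/-- The measure with density `p` with respect to `ν`. -/
def densityMeasure {α : Type*} [MeasurableSpace α] (ν : Measure α) (p : α → ℝ) : Measure α :=
  ν.withDensity fun x => ENNReal.ofReal (p x)

/-- The member `f_{η,σ}(y) = σ⁻¹ f((y - η)/σ)` of the location-scale family generated by `f`. -/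
def lsDensity (f : ℝ → ℝ) (η σ : ℝ) (y : ℝ) : ℝ :=
  1 / σ * f ((y - η) / σ)

/-- The Kullback-Leibler divergence `D(f_{0,1} ‖ f_{η,σ})`, as a function of `(η, σ)`. -/
def lsKL (f : ℝ → ℝ) (θ : ℝ × ℝ) : ENNReal :=
  InformationTheory.klDiv (densityMeasure volume (lsDensity f 0 1))
    (densityMeasure volume (lsDensity f θ.1 θ.2))

/-- `D(f_{0,1} ‖ f_{η,σ})` is finite and continuous in `(η, σ) ∈ ℝ × (0, ∞)`. -/
def KLFiniteContinuous (f : ℝ → ℝ) : Prop :=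
  (∀ θ : ℝ × ℝ, 0 < θ.2 → lsKL f θ < ⊤) ∧ ContinuousOn (lsKL f) {θ : ℝ × ℝ | 0 < θ.2}

/-- `D(f_{0,1} ‖ f_{η,σ}) = O(η² + (1 - σ)²)` for `(η, σ)` near `(0, 1)`. -/
def KLLocallyQuadratic (f : ℝ → ℝ) : Prop :=
  ∃ K : ℝ, ∀ᶠ θ : ℝ × ℝ in 𝓝 (0, 1), lsKL f θ ≤ ENNReal.ofReal (K * (θ.1 ^ 2 + (1 - θ.2) ^ 2))

/-- The pair `(ξ₁, ξ₂)` of square integrable functions is the Hellinger derivative of the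
location-scale family at `(0, 1)`: the `L²` norm of
`√f_{η,σ} - √f_{0,1} - η ξ₁ - (σ - 1) ξ₂` is `o(|(η, σ) - (0, 1)|)`. -/
def HasHellingerDeriv (f ξ₁ ξ₂ : ℝ → ℝ) : Prop :=
  MemLp ξ₁ 2 volume ∧ MemLp ξ₂ 2 volume ∧
  (fun θ : ℝ × ℝ => (eLpNorm (fun y => √(lsDensity f θ.1 θ.2 y) - √(lsDensity f 0 1 y)
      - (θ.1 * ξ₁ y + (θ.2 - 1) * ξ₂ y)) 2 volume).toReal)
    =o[𝓝 (0, 1)] fun θ : ℝ × ℝ => √(θ.1 ^ 2 + (θ.2 - 1) ^ 2)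

/-- The location-scale family is Hellinger differentiable at `(0, 1)` and the two components of
the derivative are linearly independent (as elements of `L²`). -/
def HellingerNondegenerate (f : ℝ → ℝ) : Prop :=
  ∃ ξ₁ ξ₂ : ℝ → ℝ, HasHellingerDeriv f ξ₁ ξ₂ ∧
    ∀ a b : ℝ, (∀ᵐ y ∂volume, a * ξ₁ y + b * ξ₂ y = 0) → a = 0 ∧ b = 0

/-- The squared `L₂(h)` distance `‖u - v‖²_{2,h} = ∫ (u - v)² h dν`. -/
def sqDist {𝒳 : Type*} [MeasurableSpace 𝒳] (ν : Measure 𝒳) (h u v : 𝒳 → ℝ) : ENNReal :=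
  ∫⁻ x, ENNReal.ofReal ((u x - v x) ^ 2 * h x) ∂ν

/-- `N` is an `ε`-packing set in `V` for the `L₂(h)` distance: distinct members are at distance
greater than `ε` (the definition is used for `ε > 0`). -/
def IsPacking {𝒳 : Type*} [MeasurableSpace 𝒳] (ν : Measure 𝒳) (h : 𝒳 → ℝ) (V : Set (𝒳 → ℝ))
    (ε : ℝ) (N : Finset (𝒳 → ℝ)) : Prop :=
  (∀ u ∈ N, u ∈ V) ∧ ∀ u ∈ N, ∀ v ∈ N, u ≠ v → ENNReal.ofReal (ε ^ 2) < sqDist ν h u v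

/-- The packing `ε`-entropy of `V` in the `L₂(h)` distance: the logarithm of the maximal cardinality
of an `ε`-packing set, equal to `⊤` if these cardinalities are unbounded. -/
def packingEntropy {𝒳 : Type*} [MeasurableSpace 𝒳] (ν : Measure 𝒳) (h : 𝒳 → ℝ)
    (V : Set (𝒳 → ℝ)) (ε : ℝ) : ENNReal :=
  ⨆ (N : Finset (𝒳 → ℝ)) (_ : IsPacking ν h V ε N), ENNReal.ofReal (Real.log N.card)

/-- `M` is an order of the entropy function `K`: `M(ε) ≍ K(ε)` as `ε → 0+`. -/
def IsEntropyOrder (M : ℝ → ℝ) (K : ℝ → ENNReal) : Prop :=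
  ∃ a b : ℝ, 0 < a ∧ 0 < b ∧ ∀ᶠ ε in 𝓝[>] (0 : ℝ),
    0 ≤ M ε ∧ ENNReal.ofReal (a * M ε) ≤ K ε ∧ K ε ≤ ENNReal.ofReal (b * M ε)

/-- Richness: `liminf_{ε → 0+} M(αε)/M(ε) > 1` for some `0 < α < 1`. -/
def Rich (M : ℝ → ℝ) : Prop :=
  ∃ α : ℝ, 0 < α ∧ α < 1 ∧
    1 < liminf (fun ε : ℝ => ((M (α * ε) / M ε : ℝ) : EReal)) (𝓝[>] (0 : ℝ))

/-- Order regularity: `M(cε) ≍ M(ε)` as `ε → 0+`, for every `c > 0`. -/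
def OrderRegular (M : ℝ → ℝ) : Prop :=
  ∀ c : ℝ, 0 < c → (fun ε : ℝ => M (c * ε)) =Θ[𝓝[>] (0 : ℝ)] M

/-- The law of one observation `(X, Y)`, `Y = μ(X) + σ(X) e`, where `X` has density `h` with respect
to `ν`, `e` has Lebesgue density `f`, and `X`, `e` are independent. -/
def obsLaw {𝒳 : Type*} [MeasurableSpace 𝒳] (ν : Measure 𝒳) (f : ℝ → ℝ) (μ σ h : 𝒳 → ℝ) :
    Measure (𝒳 × ℝ) :=
  ((densityMeasure ν h).prod (densityMeasure volume f)).map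
    fun z => (z.1, μ z.1 + σ z.1 * z.2)

/-- The risk `𝔼 ‖μ - μ̂‖²_{2,h}` of an estimator based on `n` i.i.d. observations. -/
def risk {𝒳 : Type*} [MeasurableSpace 𝒳] (ν : Measure 𝒳) (f : ℝ → ℝ) {n : ℕ}
    (est : (Fin n → 𝒳 × ℝ) → 𝒳 → ℝ) (μ σ h : 𝒳 → ℝ) : ENNReal :=
  ∫⁻ z, sqDist ν h μ (est z) ∂(Measure.pi fun _ : Fin n => obsLaw ν f μ σ h)

/-- The minimax risk: the infimum is over all (jointly measurable) estimators, the supremum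
over `μ ∈ U`, `σ ∈ S`, `h ∈ H`. -/
def minimaxRisk {𝒳 : Type*} [MeasurableSpace 𝒳] (ν : Measure 𝒳) (f : ℝ → ℝ)
    (U S H : Set (𝒳 → ℝ)) (n : ℕ) : ENNReal :=
  ⨅ (est : (Fin n → 𝒳 × ℝ) → 𝒳 → ℝ) (_ : Measurable (Function.uncurry est)),
    ⨆ μ ∈ U, ⨆ σ ∈ S, ⨆ h ∈ H, risk ν f est μ σ h

end LocScale

end

/-!
By a change of variables, the family `f_{η,σ}` at two arbitrary parameters is the family at
`(0, 1)` and one other parameter. A nontrivial affine map preserves no probability measure without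
atoms, so `f_{η,σ}` differs from `f` away from `(0, 1)`. The local assumptions, continuity, and
compactness of the parameter box therefore bound the Kullback-Leibler divergence above, and the
squared Hellinger distance below, by multiples of the squared distance of the parameters.
Integrating over the design, both divergences between laws of observations compare with squared
`L₂(h)` distances.

*Upper bound.* The maximum likelihood estimator over a product of `ε_n`-nets of `U` and `S` has
expected squared Hellinger loss at most `K ε_n² + (log of the cardinality) / n`, by a union bound
for the square roots of the likelihood ratios; the second term is `O(M(ε_n) / n) = O(ε_n²)`.

*Lower bound.* Fix `σ` and the dominating design density. An `ε_n`-net of `U` covers `U` by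
`exp(O(M(ε_n)))` balls of Kullback-Leibler radius `O(n ε_n²) = O(M(ε_n))`, while richness yields,
for a small constant `c`, a `c ε_n`-packing of `U` whose log-cardinality exceeds any prescribed
multiple of `M(ε_n) + 1`. The balls around the packing points are disjoint events, so under the
net their total probability is at most the size of the net; a change of measure then leaves some
packing point whose ball has probability at most `1/2` under its own law.
-/

namespace LocScale

open InformationTheory

section Densities

variable {Ω ι : Type*} [MeasurableSpace Ω] [Fintype ι] {m : Measure Ω} {p : Ω → ℝ}

theorem densityMeasure_apply {A : Set Ω} (hA : MeasurableSet A) :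
    densityMeasure m p A = ∫⁻ x in A, ENNReal.ofReal (p x) ∂m :=
  withDensity_apply _ hA

theorem IsDensity.isProbabilityMeasure (hp : IsDensity m p) :
    IsProbabilityMeasure (densityMeasure m p) :=
  ⟨by rw [densityMeasure_apply .univ, setLIntegral_univ, hp.lintegral_eq_one]⟩

theorem IsDensity.integrable (hp : IsDensity m p) : Integrable p m := by
  refine ⟨hp.measurable.aestronglyMeasurable, ?_⟩
  rw [hasFiniteIntegral_iff_ofReal (.of_forall hp.nonneg), hp.lintegral_eq_one]
  exact ENNReal.one_lt_top

theorem IsDensity.integral_eq_one (hp : IsDensity m p) : ∫ x, p x ∂m = 1 := by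
  rw [integral_eq_lintegral_of_nonneg_ae (.of_forall hp.nonneg)
    hp.measurable.aestronglyMeasurable, hp.lintegral_eq_one, ENNReal.toReal_one]

theorem lintegral_densityMeasure (hp : Measurable p) {F : Ω → ENNReal} (hF : Measurable F) :
    ∫⁻ x, F x ∂densityMeasure m p = ∫⁻ x, ENNReal.ofReal (p x) * F x ∂m :=
  lintegral_withDensity_eq_lintegral_mul _ hp.ennreal_ofReal hF

theorem IsDensity.integrable_densityMeasure_iff (hp : IsDensity m p) {F : Ω → ℝ} :
    Integrable F (densityMeasure m p) ↔ Integrable (fun x => p x * F x) m := by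
  rw [densityMeasure, integrable_withDensity_iff_integrable_smul' hp.measurable.ennreal_ofReal
    (.of_forall fun x => ENNReal.ofReal_lt_top)]
  simp only [ENNReal.toReal_ofReal (hp.nonneg _), smul_eq_mul]

theorem IsDensity.integral_densityMeasure (hp : IsDensity m p) (F : Ω → ℝ) :
    ∫ x, F x ∂densityMeasure m p = ∫ x, p x * F x ∂m := by
  rw [densityMeasure, integral_withDensity_eq_integral_toReal_smul hp.measurable.ennreal_ofReal
    (.of_forall fun x => ENNReal.ofReal_lt_top)]
  simp only [ENNReal.toReal_ofReal (hp.nonneg _), smul_eq_mul]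

theorem ae_densityMeasure_iff (hp : Measurable p) {R : Ω → Prop} :
    (∀ᵐ x ∂densityMeasure m p, R x) ↔ ∀ᵐ x ∂m, 0 < p x → R x := by
  rw [densityMeasure, ae_withDensity_iff hp.ennreal_ofReal]
  simp

/-- The joint density of independent draws, one for each index in `ι`, from the density `p`. -/
def prodDensity (p : Ω → ℝ) (z : ι → Ω) : ℝ := ∏ i, p (z i)

theorem measurable_prodDensity (hp : Measurable p) :
    Measurable (prodDensity p : (ι → Ω) → ℝ) := by
  unfold prodDensity
  fun_prop

theorem indicator_pi_prodDensity {Ω : Type*} (s : ι → Set Ω) (p : Ω → ℝ)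
    (z : ι → Ω) :
    (Set.univ.pi s).indicator (prodDensity p) z = ∏ i, (s i).indicator p (z i) := by
  by_cases hz : z ∈ Set.univ.pi s
  · rw [Set.indicator_of_mem hz, prodDensity]
    exact Finset.prod_congr rfl fun i _ => (Set.indicator_of_mem (hz i trivial) p).symm
  · obtain ⟨i, hi⟩ : ∃ i, z i ∉ s i := by simpa using hz
    rw [Set.indicator_of_notMem hz, Finset.prod_eq_zero (Finset.mem_univ i)
      (Set.indicator_of_notMem hi p)]

variable [SigmaFinite m]

theorem IsDensity.pi_densityMeasure (hp : IsDensity m p) :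
    (Measure.pi fun _ : ι => densityMeasure m p)
      = densityMeasure (Measure.pi fun _ : ι => m) (prodDensity p) := by
  have := hp.isProbabilityMeasure
  refine Measure.pi_eq fun s hs => ?_
  have hint (i : ι) : Integrable ((s i).indicator p) m := hp.integrable.indicator (hs i)
  have hnonneg (i : ι) (x : Ω) : 0 ≤ (s i).indicator p x :=
    Set.indicator_nonneg (fun x _ => hp.nonneg x) x
  have happly (i : ι) :
      densityMeasure m p (s i) = ENNReal.ofReal (∫ x, (s i).indicator p x ∂m) := by
    rw [densityMeasure_apply (hs i), integral_indicator (hs i),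
      ofReal_integral_eq_lintegral_ofReal hp.integrable.restrict (.of_forall hp.nonneg)]
  have hpi : MeasurableSet (Set.univ.pi s) := .univ_pi hs
  calc densityMeasure (Measure.pi fun _ => m) (prodDensity p) (Set.univ.pi s)
      = ∫⁻ z, ENNReal.ofReal (∏ i, (s i).indicator p (z i)) ∂Measure.pi fun _ => m := by
        simp only [densityMeasure_apply hpi, ← lintegral_indicator hpi, ← indicator_pi_prodDensity]
        exact lintegral_congr fun z => (congrFun (Set.indicator_comp_of_zero
          (g := ENNReal.ofReal) ENNReal.ofReal_zero) z)
    _ = ENNReal.ofReal (∏ i, ∫ x, (s i).indicator p x ∂m) := by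
        rw [← integral_fintype_prod_eq_prod, ofReal_integral_eq_lintegral_ofReal
          (Integrable.fintype_prod hint)
          (.of_forall fun z => Finset.prod_nonneg fun i _ => hnonneg i _)]
    _ = ∏ i, densityMeasure m p (s i) := by
        simp only [happly, ENNReal.ofReal_prod_of_nonneg fun i _ => integral_nonneg (hnonneg i)]

theorem IsDensity.prodDensity (hp : IsDensity m p) :
    IsDensity (Measure.pi fun _ : ι => m) (prodDensity p) where
  measurable := measurable_prodDensity hp.measurable
  nonneg _ := Finset.prod_nonneg fun _ _ => hp.nonneg _
  lintegral_eq_one := by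
    have := hp.isProbabilityMeasure
    rw [← setLIntegral_univ, ← densityMeasure_apply .univ, ← hp.pi_densityMeasure, measure_univ]

end Densities

section KullbackLeibler

open ProbabilityTheory

theorem klDiv_map_measurableEquiv {α β : Type*} [MeasurableSpace α] [MeasurableSpace β]
    (P Q : Measure α) [IsFiniteMeasure P] [IsFiniteMeasure Q] (e : α ≃ᵐ β) :
    klDiv (P.map e) (Q.map e) = klDiv P Q := by
  refine (klDiv_map_le P Q e.measurable).antisymm ?_
  simpa using klDiv_map_le (P.map e) (Q.map e) e.symm.measurable

theorem klDiv_prod {α β : Type*} [MeasurableSpace α] [MeasurableSpace β]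
    (P P' : Measure α) (Q Q' : Measure β) [IsProbabilityMeasure P] [IsProbabilityMeasure P']
    [IsProbabilityMeasure Q] [IsProbabilityMeasure Q'] :
    klDiv (P.prod Q) (P'.prod Q') = klDiv P P' + klDiv Q Q' := by
  have hswap : klDiv (P.prod Q) (P.prod Q') = klDiv Q Q' := by
    rw [← klDiv_map_measurableEquiv _ _ MeasurableEquiv.prodComm]
    simp only [MeasurableEquiv.prodComm, MeasurableEquiv.coe_mk, Equiv.coe_prodComm,
      Measure.prod_swap]
    rw [← Measure.compProd_const, ← Measure.compProd_const, klDiv_compProd_left]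
  rw [← hswap, ← Measure.compProd_const, ← Measure.compProd_const, ← Measure.compProd_const,
    klDiv_compProd_eq_add]

theorem klDiv_pi {α : Type*} [MeasurableSpace α] {n : ℕ} (P Q : Fin n → Measure α)
    [∀ i, IsProbabilityMeasure (P i)] [∀ i, IsProbabilityMeasure (Q i)] :
    klDiv (Measure.pi P) (Measure.pi Q) = ∑ i, klDiv (P i) (Q i) := by
  induction n with
  | zero => simp [Measure.pi_of_empty P, Measure.pi_of_empty Q]
  | succ n ih =>
    rw [← klDiv_map_measurableEquiv _ _ (MeasurableEquiv.piFinSuccAbove (fun _ => α) 0),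
      (measurePreserving_piFinSuccAbove P 0).map_eq, (measurePreserving_piFinSuccAbove Q 0).map_eq,
      klDiv_prod, ih, Fin.sum_univ_succAbove _ 0]

variable {Ω : Type*} [MeasurableSpace Ω]

theorem ofReal_mul_measure_exp_lt_rnDeriv_le (P Q : Measure Ω) [IsProbabilityMeasure P]
    [IsProbabilityMeasure Q] {t : ℝ} :
    ENNReal.ofReal t * P {x | Real.exp t < (P.rnDeriv Q x).toReal} ≤ klDiv P Q + 1 := by
  by_cases hac : P ≪ Q
  swap
  · simp [klDiv_of_not_ac hac]
  set B : Set Ω := {x | Real.exp t < (P.rnDeriv Q x).toReal}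
  have hB : MeasurableSet B :=
    measurableSet_lt measurable_const (Measure.measurable_rnDeriv P Q).ennreal_toReal
  have hpt {r : ℝ} (hr : Real.exp t < r) :
      ENNReal.ofReal t * ENNReal.ofReal r ≤ ENNReal.ofReal (klFun r) + ENNReal.ofReal r := by
    have hr0 : 0 < r := (Real.exp_pos t).trans hr
    have hlog : t ≤ Real.log r := ((Real.lt_log_iff_exp_lt hr0).2 hr).le
    rw [← ENNReal.ofReal_mul' hr0.le, ← ENNReal.ofReal_add (klFun_nonneg hr0.le) hr0.le, klFun]
    exact ENNReal.ofReal_le_ofReal (by nlinarith)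
  calc ENNReal.ofReal t * P B
      = ∫⁻ x in B, ENNReal.ofReal t * P.rnDeriv Q x ∂Q := by
        rw [lintegral_const_mul _ (Measure.measurable_rnDeriv P Q),
          Measure.setLIntegral_rnDeriv hac]
    _ ≤ ∫⁻ x in B, ENNReal.ofReal (klFun (P.rnDeriv Q x).toReal) + P.rnDeriv Q x ∂Q := by
        refine setLIntegral_mono_ae' hB ?_
        filter_upwards [Measure.rnDeriv_lt_top P Q] with x hx hxB
        simpa only [ENNReal.ofReal_toReal hx.ne] using hpt hxB
    _ ≤ ∫⁻ x, ENNReal.ofReal (klFun (P.rnDeriv Q x).toReal) + P.rnDeriv Q x ∂Q :=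
        setLIntegral_le_lintegral _ _
    _ = klDiv P Q + 1 := by
        rw [lintegral_add_right _ (Measure.measurable_rnDeriv P Q),
          ← klDiv_eq_lintegral_klFun_of_ac hac, Measure.lintegral_rnDeriv hac, measure_univ]

theorem measure_le_exp_mul_add_klDiv (P Q : Measure Ω) [IsProbabilityMeasure P]
    [IsProbabilityMeasure Q] {A : Set Ω} (hA : MeasurableSet A) {t : ℝ} (ht : 0 < t) :
    P A ≤ ENNReal.ofReal (Real.exp t) * Q A + (klDiv P Q + 1) / ENNReal.ofReal t := by
  by_cases hac : P ≪ Q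
  swap
  · simp [klDiv_of_not_ac hac, ENNReal.top_div_of_ne_top]
  set B : Set Ω := {x | Real.exp t < (P.rnDeriv Q x).toReal}
  have hB : MeasurableSet B :=
    measurableSet_lt measurable_const (Measure.measurable_rnDeriv P Q).ennreal_toReal
  have hsmall : P (A \ B) ≤ ENNReal.ofReal (Real.exp t) * Q A := by
    rw [← Measure.setLIntegral_rnDeriv hac, ← setLIntegral_const]
    refine (setLIntegral_mono_ae' (hA.diff hB) ?_).trans
      (lintegral_mono_set (Set.sdiff_subset (t := B)))
    filter_upwards [Measure.rnDeriv_lt_top P Q] with x hx hxB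
    exact ENNReal.le_ofReal_iff_toReal_le hx.ne (Real.exp_pos t).le |>.2 (not_lt.1 hxB.2)
  have hlarge : P B ≤ (klDiv P Q + 1) / ENNReal.ofReal t := by
    rw [ENNReal.le_div_iff_mul_le (.inl (by simpa using ht)) (.inl ENNReal.ofReal_ne_top),
      mul_comm]
    exact ofReal_mul_measure_exp_lt_rnDeriv_le P Q
  calc P A ≤ P (A \ B ∪ B) := measure_mono (by simp)
    _ ≤ P (A \ B) + P B := measure_union_le _ _
    _ ≤ _ := add_le_add hsmall hlarge

end KullbackLeibler

section KullbackLeiblerDensity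

/-- The contribution `a log (a / b) + b - a` of a point with density values `a, b ≥ 0` to the
Kullback-Leibler divergence; it is infinite where absolute continuity fails. -/
noncomputable def klTerm (a b : ℝ) : ENNReal :=
  if b = 0 ∧ a ≠ 0 then ⊤ else ENNReal.ofReal (b * klFun (a / b))

theorem measurable_klTerm : Measurable fun z : ℝ × ℝ => klTerm z.1 z.2 := by
  unfold klTerm
  refine Measurable.ite ?_ measurable_const (by fun_prop)
  exact (measurable_snd (measurableSet_singleton 0)).inter
    (measurable_fst (measurableSet_singleton 0).compl)

variable {Ω : Type*} [MeasurableSpace Ω] {m : Measure Ω} {p q : Ω → ℝ}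

theorem IsDensity.eq_withDensity_div (hp : IsDensity m p) (hq : IsDensity m q)
    (hpq : ∀ᵐ x ∂m, q x = 0 → p x = 0) :
    densityMeasure m p
      = (densityMeasure m q).withDensity fun x => ENNReal.ofReal (p x / q x) := by
  have := hp.measurable
  have := hq.measurable
  rw [densityMeasure, densityMeasure, ← withDensity_mul _ (by fun_prop) (by fun_prop)]
  refine withDensity_congr_ae ?_
  filter_upwards [hpq] with x hx
  rw [Pi.mul_apply, ← ENNReal.ofReal_mul (hq.nonneg x), mul_div_cancel_of_imp' hx]

theorem IsDensity.absolutelyContinuous_iff (hp : IsDensity m p) (hq : IsDensity m q) :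
    densityMeasure m p ≪ densityMeasure m q ↔ ∀ᵐ x ∂m, q x = 0 → p x = 0 := by
  refine ⟨fun h => ?_, fun h => ?_⟩
  · have hq' : ∀ᵐ x ∂densityMeasure m q, 0 < q x :=
      (ae_densityMeasure_iff hq.measurable).2 (.of_forall fun _ hx => hx)
    filter_upwards [(ae_densityMeasure_iff hp.measurable).1 (h.ae_le hq')] with x hx hqx
    exact ((hp.nonneg x).eq_or_lt.resolve_right fun hpx => (hx hpx).ne' hqx).symm
  · rw [hp.eq_withDensity_div hq h]
    exact withDensity_absolutelyContinuous _ _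

theorem IsDensity.rnDeriv_ae_eq_div (hp : IsDensity m p) (hq : IsDensity m q)
    (hac : densityMeasure m p ≪ densityMeasure m q) :
    (densityMeasure m p).rnDeriv (densityMeasure m q)
      =ᵐ[densityMeasure m q] fun x => ENNReal.ofReal (p x / q x) := by
  have := hq.isProbabilityMeasure
  have := hp.measurable
  have := hq.measurable
  rw [hp.eq_withDensity_div hq ((hp.absolutelyContinuous_iff hq).1 hac)]
  exact Measure.rnDeriv_withDensity _ (by fun_prop)

theorem IsDensity.llr_ae_eq_log_div (hp : IsDensity m p) (hq : IsDensity m q)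
    (hac : densityMeasure m p ≪ densityMeasure m q) :
    llr (densityMeasure m p) (densityMeasure m q)
      =ᵐ[densityMeasure m p] fun x => Real.log (p x / q x) := by
  filter_upwards [hac.ae_le (hp.rnDeriv_ae_eq_div hq hac)] with x hx
  rw [llr, hx, ENNReal.toReal_ofReal (div_nonneg (hp.nonneg x) (hq.nonneg x))]

theorem IsDensity.klDiv_eq_lintegral_klTerm (hp : IsDensity m p) (hq : IsDensity m q) :
    klDiv (densityMeasure m p) (densityMeasure m q) = ∫⁻ x, klTerm (p x) (q x) ∂m := by
  have := hp.isProbabilityMeasure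
  have := hq.isProbabilityMeasure
  have hpm := hp.measurable
  have hqm := hq.measurable
  by_cases hac : densityMeasure m p ≪ densityMeasure m q
  · calc klDiv (densityMeasure m p) (densityMeasure m q)
        = ∫⁻ x, ENNReal.ofReal (klFun (p x / q x)) ∂densityMeasure m q := by
          rw [klDiv_eq_lintegral_klFun_of_ac hac]
          refine lintegral_congr_ae ?_
          filter_upwards [hp.rnDeriv_ae_eq_div hq hac] with x hx
          rw [hx, ENNReal.toReal_ofReal (div_nonneg (hp.nonneg x) (hq.nonneg x))]
      _ = ∫⁻ x, ENNReal.ofReal (q x) * ENNReal.ofReal (klFun (p x / q x)) ∂m :=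
          lintegral_densityMeasure hqm (by fun_prop)
      _ = ∫⁻ x, klTerm (p x) (q x) ∂m := by
          refine lintegral_congr_ae ?_
          filter_upwards [(hp.absolutelyContinuous_iff hq).1 hac] with x hx
          rw [klTerm, if_neg fun h => h.2 (hx h.1), ENNReal.ofReal_mul (hq.nonneg x)]
  · rw [klDiv_of_not_ac hac]
    by_contra hfin
    refine hac ((hp.absolutelyContinuous_iff hq).2 ?_)
    filter_upwards [ae_lt_top (measurable_klTerm.comp (hpm.prodMk hqm)) (Ne.symm hfin)]
      with x hx hqx
    by_contra hpx
    exact hx.ne (if_pos ⟨hqx, hpx⟩)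

end KullbackLeiblerDensity

section Hellinger

variable {Ω : Type*} [MeasurableSpace Ω] {m : Measure Ω} {p q : Ω → ℝ}

/-- The squared Hellinger distance `∫ (√p - √q)² dm` between densities, without a factor `1 / 2`. -/
noncomputable def hellingerSq (m : Measure Ω) (p q : Ω → ℝ) : ENNReal :=
  ∫⁻ x, ENNReal.ofReal ((√(p x) - √(q x)) ^ 2) ∂m

theorem IsDensity.integrable_sqrt_mul (hp : IsDensity m p) (hq : IsDensity m q) :
    Integrable (fun x => √(p x * q x)) m := by
  have hpm := hp.measurable
  have hqm := hq.measurable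
  refine (hp.integrable.add hq.integrable).mono' (by fun_prop) (.of_forall fun x => ?_)
  have hpx := hp.nonneg x
  have hqx := hq.nonneg x
  rw [Real.norm_of_nonneg (Real.sqrt_nonneg _), Pi.add_apply, Real.sqrt_le_left (by positivity)]
  nlinarith

theorem IsDensity.integral_sqrt_mul (hp : IsDensity m p) (hq : IsDensity m q) :
    ∫ x, √(p x * q x) ∂m = 1 - (hellingerSq m p q).toReal / 2 := by
  have hexpand (x : Ω) : (√(p x) - √(q x)) ^ 2 = p x + q x - 2 * √(p x * q x) := by
    rw [Real.sqrt_mul (hp.nonneg x), sub_sq, Real.sq_sqrt (hp.nonneg x),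
      Real.sq_sqrt (hq.nonneg x)]
    ring
  have hpm := hp.measurable
  have hqm := hq.measurable
  rw [hellingerSq, ← integral_eq_lintegral_of_nonneg_ae (.of_forall fun x => sq_nonneg _)
    (by fun_prop)]
  simp only [hexpand]
  rw [integral_sub (f := fun x => p x + q x) (hp.integrable.add hq.integrable)
      ((hp.integrable_sqrt_mul hq).const_mul 2), integral_add hp.integrable hq.integrable,
    hp.integral_eq_one, hq.integral_eq_one, integral_const_mul]
  ring

theorem IsDensity.hellingerSq_ne_top (hp : IsDensity m p) (hq : IsDensity m q) :
    hellingerSq m p q ≠ ⊤ := by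
  have hpm := hp.measurable
  refine ne_top_of_le_ne_top (b := ∫⁻ x, (ENNReal.ofReal (p x) + ENNReal.ofReal (q x)) ∂m) ?_ ?_
  · rw [lintegral_add_left hpm.ennreal_ofReal, hp.lintegral_eq_one, hq.lintegral_eq_one]
    finiteness
  · refine lintegral_mono fun x => ?_
    rw [← ENNReal.ofReal_add (hp.nonneg x) (hq.nonneg x)]
    refine ENNReal.ofReal_le_ofReal ?_
    nlinarith [Real.sq_sqrt (hp.nonneg x), Real.sq_sqrt (hq.nonneg x),
      mul_nonneg (Real.sqrt_nonneg (p x)) (Real.sqrt_nonneg (q x))]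

theorem IsDensity.mul_sqrt_div (hp : IsDensity m p) (q : Ω → ℝ) (x : Ω) :
    p x * √(q x / p x) = √(p x * q x) := by
  rcases (hp.nonneg x).eq_or_lt with h | h
  · simp [← h]
  · rw [show p x * q x = p x ^ 2 * (q x / p x) by field_simp, Real.sqrt_mul (by positivity),
      Real.sqrt_sq h.le]

theorem IsDensity.integrable_sqrt_div (hp : IsDensity m p) (hq : IsDensity m q) :
    Integrable (fun x => √(q x / p x)) (densityMeasure m p) := by
  simpa only [hp.integrable_densityMeasure_iff, hp.mul_sqrt_div] using hp.integrable_sqrt_mul hq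

theorem IsDensity.integral_sqrt_div (hp : IsDensity m p) (q : Ω → ℝ) :
    ∫ x, √(q x / p x) ∂densityMeasure m p = ∫ x, √(p x * q x) ∂m := by
  simp only [hp.integral_densityMeasure, hp.mul_sqrt_div]

theorem integral_sqrt_prodDensity_mul [SigmaFinite m] {ι : Type*} [Fintype ι]
    (hp : ∀ x, 0 ≤ p x) (hq : ∀ x, 0 ≤ q x) :
    ∫ z : ι → Ω, √(prodDensity p z * prodDensity q z) ∂(Measure.pi fun _ => m)
      = (∫ x, √(p x * q x) ∂m) ^ Fintype.card ι := by
  simp only [prodDensity, ← Finset.prod_mul_distrib,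
    Real.sqrt_prod _ fun _ _ => mul_nonneg (hp _) (hq _)]
  rw [integral_fintype_prod_eq_prod (fun (_ : ι) x => √(p x * q x)), Finset.prod_const,
    Finset.card_univ]

end Hellinger

section MaximumLikelihood

variable {Ω ι : Type*} [MeasurableSpace Ω] [Fintype ι] {m : Measure Ω} {p : Ω → ℝ}
  {q : ι → Ω → ℝ} {d : ι → ℝ} {j₀ : ι}

theorem integral_sum_exp_mul_sqrt_div_le (hp : IsDensity m p) (hq : ∀ j, IsDensity m (q j))
    (hd : ∀ j, ∫ x, √(p x * q j x) ∂m ≤ Real.exp (-d j)) :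
    ∫ x, ∑ j, Real.exp (d j) * √(q j x / p x) ∂densityMeasure m p ≤ Fintype.card ι := by
  rw [integral_finsetSum _ fun j _ => (hp.integrable_sqrt_div (hq j)).const_mul _]
  calc ∑ j, ∫ x, Real.exp (d j) * √(q j x / p x) ∂densityMeasure m p
      ≤ ∑ _j : ι, (1 : ℝ) := Finset.sum_le_sum fun j _ => by
        rw [integral_const_mul, hp.integral_sqrt_div]
        calc _ ≤ Real.exp (d j) * Real.exp (-d j) := by gcongr; exact hd j
          _ = 1 := by rw [← Real.exp_add, add_neg_cancel, Real.exp_zero]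
    _ = Fintype.card ι := by simp

-- The logarithm of the sum is replaced by its tangent at `card ι`, so that it can be integrated.
theorem le_sum_exp_mul_sqrt_div {a b : ℝ} {c d : ι → ℝ} (ha : 0 < a) (hb : 0 < b) {j : ι}
    (hj : b ≤ c j) :
    d j ≤ (∑ i, Real.exp (d i) * √(c i / a)) / Fintype.card ι
      + (Real.log (Fintype.card ι) - 1) + Real.log (a / b) / 2 := by
  have hcard : (0 : ℝ) < Fintype.card ι := Nat.cast_pos.2 (Fintype.card_pos_iff.2 ⟨j⟩)
  set T := ∑ i, Real.exp (d i) * √(c i / a)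
  have hT : Real.exp (d j) * √(b / a) ≤ T :=
    calc Real.exp (d j) * √(b / a) ≤ Real.exp (d j) * √(c j / a) := by gcongr
      _ ≤ T := Finset.single_le_sum (f := fun i => Real.exp (d i) * √(c i / a))
          (fun i _ => by positivity) (Finset.mem_univ j)
  have hpos : 0 < Real.exp (d j) * √(b / a) := by positivity
  have hlog : d j - Real.log (a / b) / 2 ≤ Real.log T := by
    have := Real.log_le_log hpos hT
    rw [Real.log_mul (by positivity) (by positivity), Real.log_exp, Real.log_sqrt (by positivity),
      ← inv_div a b, Real.log_inv] at this
    linarith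
  have htangent := Real.log_le_sub_one_of_pos (div_pos (hpos.trans_le hT) hcard)
  rw [Real.log_div (hpos.trans_le hT).ne' hcard.ne'] at htangent
  linarith

theorem lintegral_le_of_likelihood_le (hp : IsDensity m p) (hq : ∀ j, IsDensity m (q j))
    (hKL : klDiv (densityMeasure m p) (densityMeasure m (q j₀)) ≠ ⊤) (hd₀ : ∀ j, 0 ≤ d j)
    (hd : ∀ j, ∫ x, √(p x * q j x) ∂m ≤ Real.exp (-d j)) {j : Ω → ι}
    (hj : ∀ x, q j₀ x ≤ q (j x) x) :
    ∫⁻ x, ENNReal.ofReal (d (j x)) ∂densityMeasure m p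
      ≤ ENNReal.ofReal (Real.log (Fintype.card ι)
        + (klDiv (densityMeasure m p) (densityMeasure m (q j₀))).toReal / 2) := by
  have := hp.isProbabilityMeasure
  have := (hq j₀).isProbabilityMeasure
  obtain ⟨hac, hllr⟩ := klDiv_ne_top_iff.1 hKL
  set P := densityMeasure m p
  set T : Ω → ℝ := fun x => ∑ i, Real.exp (d i) * √(q i x / p x)
  have hT : Integrable T P :=
    integrable_finsetSum _ fun i _ => (hp.integrable_sqrt_div (hq i)).const_mul _
  set G : Ω → ℝ := fun x => T x / Fintype.card ι + (Real.log (Fintype.card ι) - 1)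
    + llr P (densityMeasure m (q j₀)) x / 2
  have hdG : ∀ᵐ x ∂P, d (j x) ≤ G x := by
    have hppos : ∀ᵐ x ∂P, 0 < p x :=
      (ae_densityMeasure_iff hp.measurable).2 (.of_forall fun _ hx => hx)
    have hqpos : ∀ᵐ x ∂P, 0 < q j₀ x :=
      hac.ae_le ((ae_densityMeasure_iff (hq j₀).measurable).2 (.of_forall fun _ hx => hx))
    filter_upwards [hppos, hqpos, hp.llr_ae_eq_log_div (hq j₀) hac] with x hpx hqx hx
    simp only [G]
    rw [hx]
    exact le_sum_exp_mul_sqrt_div (c := fun i => q i x) (d := d) hpx hqx (hj x)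
  have hG : Integrable G P := ((hT.div_const _).add (integrable_const _)).add (hllr.div_const 2)
  calc ∫⁻ x, ENNReal.ofReal (d (j x)) ∂P ≤ ∫⁻ x, ENNReal.ofReal (G x) ∂P :=
        lintegral_mono_ae (hdG.mono fun x hx => ENNReal.ofReal_le_ofReal hx)
    _ = ENNReal.ofReal (∫ x, G x ∂P) := (ofReal_integral_eq_lintegral_ofReal hG
        (hdG.mono fun x hx => (hd₀ _).trans hx)).symm
    _ ≤ _ := ENNReal.ofReal_le_ofReal ?_
  have hTle : (∫ x, T x ∂P) / Fintype.card ι ≤ 1 :=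
    div_le_one_of_le₀ (integral_sum_exp_mul_sqrt_div_le hp hq hd) (Nat.cast_nonneg _)
  simp only [G]
  rw [integral_add (f := fun x => T x / Fintype.card ι + (Real.log (Fintype.card ι) - 1))
      ((hT.div_const _).add (integrable_const _)) (hllr.div_const 2),
    integral_add (hT.div_const _) (integrable_const _), integral_div, integral_div,
    integral_const, probReal_univ, one_smul,
    ← toReal_klDiv_of_measure_eq hac (by simp [measure_univ])]
  linarith

end MaximumLikelihood

section IndependentSample

variable {Ω ι : Type*} [MeasurableSpace Ω] [Fintype ι] {m : Measure Ω} [SigmaFinite m]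
  {p : Ω → ℝ} {q : ι → Ω → ℝ} {n : ℕ} {j : (Fin n → Ω) → ι}

theorem klDiv_prodDensity (hp : IsDensity m p) {r : Ω → ℝ} (hr : IsDensity m r) (n : ℕ) :
    klDiv (densityMeasure (Measure.pi fun _ : Fin n => m) (prodDensity p))
        (densityMeasure (Measure.pi fun _ : Fin n => m) (prodDensity r))
      = n * klDiv (densityMeasure m p) (densityMeasure m r) := by
  have := hp.isProbabilityMeasure
  have := hr.isProbabilityMeasure
  rw [← hp.pi_densityMeasure, ← hr.pi_densityMeasure, klDiv_pi, Finset.sum_const,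
    Finset.card_univ, Fintype.card_fin, nsmul_eq_mul]

theorem integral_sqrt_prodDensity_mul_le (hp : IsDensity m p) {r : Ω → ℝ} (hr : IsDensity m r)
    (n : ℕ) :
    ∫ z : Fin n → Ω, √(prodDensity p z * prodDensity r z) ∂(Measure.pi fun _ => m)
      ≤ Real.exp (-(n * (hellingerSq m p r).toReal / 2)) := by
  have hle : ∫ x, √(p x * r x) ∂m ≤ Real.exp (-((hellingerSq m p r).toReal / 2)) := by
    rw [hp.integral_sqrt_mul hr]
    exact Real.one_sub_le_exp_neg _
  rw [integral_sqrt_prodDensity_mul hp.nonneg hr.nonneg, Fintype.card_fin, mul_div_assoc,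
    ← mul_neg, Real.exp_nat_mul]
  exact pow_le_pow_left₀ (integral_nonneg fun x => Real.sqrt_nonneg _) hle n

theorem lintegral_hellingerSq_le_of_likelihood_le (hp : IsDensity m p)
    (hq : ∀ i, IsDensity m (q i)) (hj : ∀ z i, prodDensity (q i) z ≤ prodDensity (q (j z)) z)
    (i : ι) :
    n * ∫⁻ z, hellingerSq m p (q (j z)) ∂(Measure.pi fun _ => densityMeasure m p)
      ≤ 2 * ENNReal.ofReal (Real.log (Fintype.card ι))
        + n * klDiv (densityMeasure m p) (densityMeasure m (q i)) := by
  rcases n.eq_zero_or_pos with rfl | hn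
  · simp
  by_cases hKL : klDiv (densityMeasure m p) (densityMeasure m (q i)) = ⊤
  · rw [hKL, ENNReal.mul_top (by exact_mod_cast hn.ne'), add_top]
    exact le_top
  have hKLn := klDiv_prodDensity hp (hq i) n
  have hmle := lintegral_le_of_likelihood_le (d := fun i => n * (hellingerSq m p (q i)).toReal / 2)
    hp.prodDensity (fun i => (hq i).prodDensity) (hKLn ▸ by finiteness) (fun i => by positivity)
    (fun i => integral_sqrt_prodDensity_mul_le hp (hq i) n) (fun z => hj z i)
  have hscale (i : ι) : n * hellingerSq m p (q i)
      = 2 * ENNReal.ofReal (n * (hellingerSq m p (q i)).toReal / 2) := by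
    rw [← ENNReal.ofReal_toReal (a := n * hellingerSq m p (q i))
      (ENNReal.mul_ne_top (by simp) (hp.hellingerSq_ne_top (hq i))), ENNReal.toReal_mul,
      ENNReal.toReal_natCast, ← ENNReal.ofReal_ofNat, ← ENNReal.ofReal_mul zero_le_two,
      mul_div_cancel₀ _ two_ne_zero]
  calc n * ∫⁻ z, hellingerSq m p (q (j z)) ∂(Measure.pi fun _ => densityMeasure m p)
      = 2 * ∫⁻ z, ENNReal.ofReal (n * (hellingerSq m p (q (j z))).toReal / 2)
          ∂(Measure.pi fun _ => densityMeasure m p) := by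
        rw [← lintegral_const_mul' _ _ (by simp), ← lintegral_const_mul' _ _ (by simp)]
        exact lintegral_congr fun z => hscale (j z)
    _ ≤ 2 * ENNReal.ofReal (Real.log (Fintype.card ι)
          + (n * klDiv (densityMeasure m p) (densityMeasure m (q i))).toReal / 2) := by
        rw [hp.pi_densityMeasure, ← hKLn]
        gcongr
    _ = _ := by
        rw [ENNReal.ofReal_add (Real.log_natCast_nonneg _) (by positivity), mul_add,
          ENNReal.ofReal_div_of_pos two_pos, ENNReal.ofReal_toReal (by finiteness),
          ENNReal.ofReal_ofNat, ENNReal.mul_div_cancel (by simp) (by simp)]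

end IndependentSample

section Testing

variable {Ω ι κ : Type*} [MeasurableSpace Ω]

theorem sum_measure_le_card {s : Finset ι} {t : Finset κ} {Q : κ → Measure Ω} {A : ι → Set Ω}
    (hQ : ∀ j ∈ t, IsProbabilityMeasure (Q j)) (hA : ∀ i ∈ s, MeasurableSet (A i))
    (hdisj : (s : Set ι).PairwiseDisjoint A) :
    ∑ i ∈ s, ∑ j ∈ t, Q j (A i) ≤ t.card := by
  rw [Finset.sum_comm]
  calc ∑ j ∈ t, ∑ i ∈ s, Q j (A i) ≤ ∑ _j ∈ t, 1 := Finset.sum_le_sum fun j hj => by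
        have := hQ j hj
        rw [← measure_biUnion_finset hdisj hA]
        exact prob_le_one
    _ = t.card := by simp

theorem exists_measure_le_half_of_klDiv_le {s : Finset ι} {t : Finset κ} {P : ι → Measure Ω}
    {Q : κ → Measure Ω} {A : ι → Set Ω} (hP : ∀ i ∈ s, IsProbabilityMeasure (P i))
    (hQ : ∀ j ∈ t, IsProbabilityMeasure (Q j)) (hA : ∀ i ∈ s, MeasurableSet (A i))
    (hdisj : (s : Set ι).PairwiseDisjoint A) {D : NNReal}
    (hcov : ∀ i ∈ s, ∃ j ∈ t, klDiv (P i) (Q j) ≤ D) (hs : s.Nonempty)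
    (hcard : 4 * Real.exp (4 * (D + 1)) * t.card ≤ s.card) :
    ∃ i ∈ s, P i (A i) ≤ 2⁻¹ := by
  set τ : ℝ := 4 * (D + 1)
  have hτ : (D + 1) / ENNReal.ofReal τ = 4⁻¹ := by
    rw [show τ = ((4 * (D + 1) : NNReal) : ℝ) by simp [τ], ENNReal.ofReal_coe_nnreal]
    push_cast
    rw [ENNReal.div_eq_inv_mul, ENNReal.mul_inv (by simp) (by simp), mul_assoc,
      ENNReal.inv_mul_cancel (by simp) (by finiteness), mul_one]
  have htransfer (i : ι) (hi : i ∈ s) :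
      P i (A i) ≤ ENNReal.ofReal (Real.exp τ) * ∑ j ∈ t, Q j (A i) + 4⁻¹ := by
    obtain ⟨j, hj, hKL⟩ := hcov i hi
    have := hP i hi
    have := hQ j hj
    refine (measure_le_exp_mul_add_klDiv (P i) (Q j) (hA i hi) (t := τ) (by positivity)).trans ?_
    rw [← hτ]
    gcongr
    exact Finset.single_le_sum (f := fun j => Q j (A i)) (fun _ _ => zero_le) hj
  by_contra! hlt
  refine (ENNReal.sum_lt_sum_of_nonempty hs hlt).not_ge ?_
  calc ∑ i ∈ s, P i (A i)
      ≤ ∑ i ∈ s, (ENNReal.ofReal (Real.exp τ) * ∑ j ∈ t, Q j (A i) + 4⁻¹) :=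
        Finset.sum_le_sum htransfer
    _ ≤ ENNReal.ofReal (Real.exp τ) * t.card + s.card * 4⁻¹ := by
        rw [Finset.sum_add_distrib, ← Finset.mul_sum, Finset.sum_const, nsmul_eq_mul]
        gcongr
        exact sum_measure_le_card hQ hA hdisj
    _ ≤ ENNReal.ofReal (s.card / 4) + s.card * 4⁻¹ := by
        rw [← ENNReal.ofReal_natCast t.card, ← ENNReal.ofReal_mul (Real.exp_pos _).le]
        gcongr
        linarith
    _ = ∑ _i ∈ s, 2⁻¹ := by
        rw [ENNReal.ofReal_div_of_pos (by positivity), ENNReal.ofReal_natCast, ENNReal.ofReal_ofNat,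
          div_eq_mul_inv, ← mul_add, Finset.sum_const, nsmul_eq_mul]
        congr 1
        rw [show (4 : ENNReal) = 2 * 2 by norm_num, ENNReal.mul_inv (by simp) (by simp), ← mul_add,
          ENNReal.inv_two_add_inv_two, mul_one]

end Testing

section Family

variable {f : ℝ → ℝ}

theorem lintegral_affine {s : ℝ} (hs : 0 < s) (η : ℝ) {g : ℝ → ENNReal} (hg : Measurable g) :
    ∫⁻ y, g y = ENNReal.ofReal s * ∫⁻ u, g (η + s * u) := by
  rw [← lintegral_add_left_eq_self g η]
  conv_lhs => rw [← Real.smul_map_volume_mul_left hs.ne']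
  rw [lintegral_smul_measure, abs_of_pos hs, lintegral_map (by fun_prop) (by fun_prop),
    smul_eq_mul]

theorem lsDensity_zero_one (f : ℝ → ℝ) : lsDensity f 0 1 = f := by
  funext y
  simp [lsDensity]

theorem lsDensity_affine_self (f : ℝ → ℝ) (η : ℝ) {s : ℝ} (hs : 0 < s) (u : ℝ) :
    lsDensity f η s (η + s * u) = s⁻¹ * f u := by
  rw [lsDensity, add_sub_cancel_left, mul_div_cancel_left₀ _ hs.ne', one_div]

theorem measurable_lsDensity (hf : Measurable f) (η s : ℝ) : Measurable (lsDensity f η s) := by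
  unfold lsDensity
  fun_prop

theorem densityMeasure_lsDensity (hf : Measurable f) (η : ℝ) {s : ℝ} (hs : 0 < s) :
    densityMeasure volume (lsDensity f η s)
      = (densityMeasure volume f).map fun u => η + s * u := by
  have hm := measurable_lsDensity hf η s
  refine Measure.ext_of_lintegral _ fun g hg => ?_
  rw [lintegral_map hg (by fun_prop), lintegral_densityMeasure hm hg,
    lintegral_densityMeasure hf (by fun_prop), lintegral_affine hs η (by fun_prop),
    ← lintegral_const_mul _ (by fun_prop)]
  refine lintegral_congr fun u => ?_
  rw [lsDensity_affine_self f η hs, ← mul_assoc, ← ENNReal.ofReal_mul hs.le,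
    mul_inv_cancel_left₀ hs.ne']

theorem IsDensity.lsDensity (hf : IsDensity volume f) (η : ℝ) {s : ℝ} (hs : 0 < s) :
    IsDensity volume (lsDensity f η s) where
  measurable := measurable_lsDensity hf.measurable η s
  nonneg _ := mul_nonneg (by positivity) (hf.nonneg _)
  lintegral_eq_one := by
    have := hf.isProbabilityMeasure
    rw [← setLIntegral_univ, ← densityMeasure_apply .univ,
      densityMeasure_lsDensity hf.measurable η hs, Measure.map_apply (by fun_prop) .univ,
      Set.preimage_univ, measure_univ]

/-- The parameter of `f_{θ'}` relative to `f_θ`: rescaling the observations so that `f_θ` becomes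
`f_{0,1}` turns `f_{θ'}` into `f_{relParam θ θ'}`. -/
noncomputable def relParam (θ θ' : ℝ × ℝ) : ℝ × ℝ := ((θ'.1 - θ.1) / θ.2, θ'.2 / θ.2)

theorem relParam_snd_pos {θ θ' : ℝ × ℝ} (hθ : 0 < θ.2) (hθ' : 0 < θ'.2) :
    0 < (relParam θ θ').2 :=
  div_pos hθ' hθ

theorem lsDensity_affine (f : ℝ → ℝ) {θ : ℝ × ℝ} (hθ : 0 < θ.2) (θ' : ℝ × ℝ) (u : ℝ) :
    lsDensity f θ'.1 θ'.2 (θ.1 + θ.2 * u)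
      = θ.2⁻¹ * lsDensity f (relParam θ θ').1 (relParam θ θ').2 u := by
  have harg : (u - (θ'.1 - θ.1) / θ.2) / (θ'.2 / θ.2) = (θ.1 + θ.2 * u - θ'.1) / θ'.2 := by
    field_simp
    ring
  rw [lsDensity, lsDensity, relParam, harg]
  field_simp

theorem klDiv_lsDensity (hf : IsDensity volume f) {θ θ' : ℝ × ℝ} (hθ : 0 < θ.2)
    (hθ' : 0 < θ'.2) :
    klDiv (densityMeasure volume (lsDensity f θ.1 θ.2))
        (densityMeasure volume (lsDensity f θ'.1 θ'.2)) = lsKL f (relParam θ θ') := by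
  have := hf.isProbabilityMeasure
  have hrel := relParam_snd_pos hθ hθ'
  have := (hf.lsDensity (relParam θ θ').1 hrel).isProbabilityMeasure
  have hcomp : (fun u => θ'.1 + θ'.2 * u)
      = (fun u => θ.1 + θ.2 * u) ∘ fun u => (relParam θ θ').1 + (relParam θ θ').2 * u := by
    funext u
    simp only [relParam, Function.comp_apply]
    field_simp
    ring
  rw [densityMeasure_lsDensity hf.measurable θ'.1 hθ', hcomp,
    ← Measure.map_map (by fun_prop) (by fun_prop), ← densityMeasure_lsDensity hf.measurable _ hrel,
    densityMeasure_lsDensity hf.measurable θ.1 hθ, lsKL, lsDensity_zero_one]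
  exact klDiv_map_measurableEquiv _ _
    ((MeasurableEquiv.mulLeft₀ θ.2 hθ.ne').trans (MeasurableEquiv.addLeft θ.1))

theorem hellingerSq_lsDensity (hf : Measurable f) {θ : ℝ × ℝ} (hθ : 0 < θ.2) (θ' : ℝ × ℝ) :
    hellingerSq volume (lsDensity f θ.1 θ.2) (lsDensity f θ'.1 θ'.2)
      = hellingerSq volume f (lsDensity f (relParam θ θ').1 (relParam θ θ').2) := by
  have hm := measurable_lsDensity hf
  have := hm θ.1 θ.2
  have := hm θ'.1 θ'.2
  have hinv : 0 ≤ θ.2⁻¹ := (inv_pos.2 hθ).le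
  rw [hellingerSq, hellingerSq, lintegral_affine hθ θ.1 (by fun_prop),
    ← lintegral_const_mul _ (by fun_prop)]
  refine lintegral_congr fun u => ?_
  rw [lsDensity_affine_self f θ.1 hθ, lsDensity_affine f hθ, Real.sqrt_mul hinv, Real.sqrt_mul hinv,
    ← mul_sub, mul_pow, Real.sq_sqrt hinv, ← ENNReal.ofReal_mul hθ.le, mul_inv_cancel_left₀ hθ.ne']

end Family

section Identifiability

theorem iterate_affine_sub (η s x : ℝ) (n : ℕ) :
    (fun u => η + s * u)^[n] x - x = (∑ k ∈ Finset.range n, s ^ k) * (η + s * x - x) := by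
  induction n with
  | zero => simp
  | succ n ih =>
    rw [Function.iterate_succ_apply', eq_add_of_sub_eq ih, geom_sum_succ]
    ring

/-- By Poincaré recurrence a measure-preserving map returns close to almost every point, while
the orbits of an affine map never come closer to their origin than after one step. -/
theorem map_affine_ne (P : Measure ℝ) [IsProbabilityMeasure P] [NullSingletonClass P] {η s : ℝ}
    (hs : 0 < s) (hne : (η, s) ≠ (0, 1)) : P.map (fun u => η + s * u) ≠ P := by
  intro hmap
  have hT : MeasurePreserving (fun u => η + s * u) P P := ⟨by fun_prop, hmap⟩
  have hfix : P {x | η + s * x = x} = 0 := by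
    refine Set.Subsingleton.measure_zero (fun x hx y hy => ?_) P
    by_contra hxy
    have hs1 : s = 1 := by
      have : (s - 1) * (x - y) = 0 := by
        simp only [Set.mem_ofPred_eq] at hx hy
        linarith
      exact sub_eq_zero.1 ((mul_eq_zero.1 this).resolve_right (sub_ne_zero.2 hxy))
    rw [Set.mem_ofPred_eq, hs1, one_mul, add_eq_right] at hx
    exact hne (by rw [hx, hs1])
  obtain ⟨x, hrec, hx⟩ := (hT.conservative.ae_frequently_mem_of_mem_nhds.and
    (measure_eq_zero_iff_ae_notMem.1 hfix)).exists
  have hstep : 0 < |η + s * x - x| := abs_pos.2 (sub_ne_zero.2 hx)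
  obtain ⟨n, hn, hclose⟩ := frequently_atTop.1 (hrec _ (Metric.ball_mem_nhds x hstep)) 1
  have hsum : 1 ≤ ∑ k ∈ Finset.range n, s ^ k := by
    simpa using Finset.single_le_sum (f := fun k => s ^ k) (fun k _ => by positivity)
      (Finset.mem_range.2 hn)
  rw [Metric.mem_ball, Real.dist_eq, iterate_affine_sub, abs_mul, abs_of_pos (by linarith)]
    at hclose
  exact absurd hclose (not_lt.2 (le_mul_of_one_le_left hstep.le hsum))

end Identifiability

section LocalToUniform

variable {X : Type*} {g r : X → ENNReal}

theorem exists_eventually_le_mul_of_le {l : Filter X} {a c : NNReal} (hc : c ≠ 0)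
    (hg : ∀ᶠ x in l, g x ≤ a) (hr : ∀ᶠ x in l, c ≤ r x) :
    ∃ K : NNReal, ∀ᶠ x in l, g x ≤ K * r x := by
  refine ⟨a / c, ?_⟩
  filter_upwards [hg, hr] with x hgx hrx
  calc g x ≤ a := hgx
    _ = (a / c : NNReal) * c := by rw [← ENNReal.coe_mul, div_mul_cancel₀ _ hc]
    _ ≤ _ := by gcongr

theorem exists_le_mul_of_isCompact [TopologicalSpace X] {s : Set X} (hs : IsCompact s)
    (h : ∀ x ∈ s, ∃ K : NNReal, ∀ᶠ y in 𝓝 x, g y ≤ K * r y) :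
    ∃ K : NNReal, ∀ x ∈ s, g x ≤ K * r x := by
  refine hs.induction_on (p := fun t => ∃ K : NNReal, ∀ x ∈ t, g x ≤ K * r x) ⟨0, by simp⟩
    (fun t₁ t₂ ht ⟨K, hK⟩ => ⟨K, fun x hx => hK x (ht hx)⟩) ?_ ?_
  · rintro t₁ t₂ ⟨K₁, h₁⟩ ⟨K₂, h₂⟩
    refine ⟨max K₁ K₂, ?_⟩
    rintro x (hx | hx)
    · exact (h₁ x hx).trans (by gcongr; exact le_max_left _ _)
    · exact (h₂ x hx).trans (by gcongr; exact le_max_right _ _)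
  · intro x hx
    obtain ⟨K, hK⟩ := h x hx
    exact ⟨_, mem_nhdsWithin_of_mem_nhds hK, K, fun y hy => hy⟩

end LocalToUniform

section LocalBounds

variable {f : ℝ → ℝ} {θ₀ : ℝ × ℝ}

/-- The squared distance of the parameter `(η, σ)` from `(0, 1)`. -/
noncomputable def paramSq (θ : ℝ × ℝ) : ENNReal := ENNReal.ofReal (θ.1 ^ 2 + (1 - θ.2) ^ 2)

theorem continuous_paramSq : Continuous paramSq :=
  ENNReal.continuous_ofReal.comp (by fun_prop)

theorem paramSq_ne_top (θ : ℝ × ℝ) : paramSq θ ≠ ⊤ := ENNReal.ofReal_ne_top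

theorem paramSq_ne_zero {θ : ℝ × ℝ} (h : θ ≠ (0, 1)) : paramSq θ ≠ 0 := by
  contrapose! h
  rw [paramSq, ENNReal.ofReal_eq_zero] at h
  ext
  · nlinarith [sq_nonneg (1 - θ.2)]
  · nlinarith [sq_nonneg θ.1]

theorem exists_eventually_lsKL_le (hKL : KLFiniteContinuous f) (hloc : KLLocallyQuadratic f)
    (hθ₀ : 0 < θ₀.2) : ∃ K : NNReal, ∀ᶠ θ in 𝓝 θ₀, lsKL f θ ≤ K * paramSq θ := by
  by_cases h01 : θ₀ = (0, 1)
  · obtain ⟨K, hK⟩ := hloc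
    refine ⟨K.toNNReal, ?_⟩
    rw [h01]
    filter_upwards [hK] with θ hθ
    exact hθ.trans_eq (ENNReal.ofReal_mul' (by positivity))
  · have hopen : IsOpen {θ : ℝ × ℝ | 0 < θ.2} := isOpen_lt continuous_const continuous_snd
    have hcont : ContinuousAt (lsKL f) θ₀ := hKL.2.continuousAt (hopen.mem_nhds hθ₀)
    obtain ⟨a, ha, -⟩ := ENNReal.lt_iff_exists_nnreal_btwn.1 (hKL.1 θ₀ hθ₀)
    obtain ⟨c, hc₀, hc⟩ := ENNReal.lt_iff_exists_nnreal_btwn.1 (paramSq_ne_zero h01).bot_lt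
    exact exists_eventually_le_mul_of_le (ENNReal.coe_pos.1 hc₀).ne'
      ((hcont.eventually_lt_const ha).mono fun _ => le_of_lt)
      ((continuous_paramSq.continuousAt.eventually_const_lt hc).mono fun _ => le_of_lt)

theorem abs_sub_le_sq_sqrt_sub_sqrt {a b t : ℝ} (ha : 0 ≤ a) (hb : 0 ≤ b) (ht : 0 < t) :
    |a - b| ≤ (√a - √b) ^ 2 / (2 * t) + t * (a + b) := by
  have hfactor : |a - b| = |√a - √b| * (√a + √b) := by
    rw [← abs_of_nonneg (show 0 ≤ √a + √b by positivity), ← abs_mul, mul_comm, ← sq_sub_sq,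
      Real.sq_sqrt ha, Real.sq_sqrt hb]
  have hyoung := two_mul_le_add_sq |√a - √b| (t * (√a + √b))
  have hsum : (√a + √b) ^ 2 ≤ 2 * (a + b) := by
    nlinarith [sq_nonneg (√a - √b), Real.sq_sqrt ha, Real.sq_sqrt hb]
  rw [sq_abs] at hyoung
  rw [← sub_le_iff_le_add, le_div_iff₀ (by positivity), hfactor]
  nlinarith [mul_le_mul_of_nonneg_left hsum (sq_nonneg t)]

theorem IsDensity.integrable_sq_sqrt_sub_sqrt {Ω : Type*} [MeasurableSpace Ω] {m : Measure Ω}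
    {p q : Ω → ℝ} (hp : IsDensity m p) (hq : IsDensity m q) :
    Integrable (fun x => (√(p x) - √(q x)) ^ 2) m := by
  have := hp.measurable
  have := hq.measurable
  exact (lintegral_ofReal_ne_top_iff_integrable (Measurable.aestronglyMeasurable (by fun_prop))
    (.of_forall fun x => sq_nonneg _)).1 (hp.hellingerSq_ne_top hq)

theorem IsDensity.integral_abs_sub_le {Ω : Type*} [MeasurableSpace Ω] {m : Measure Ω}
    {p q : Ω → ℝ} (hp : IsDensity m p) (hq : IsDensity m q) {t : ℝ} (ht : 0 < t) :
    ∫ x, |p x - q x| ∂m ≤ (hellingerSq m p q).toReal / (2 * t) + 2 * t := by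
  have hpm := hp.measurable
  have hqm := hq.measurable
  have hsqrt := (hp.integrable_sq_sqrt_sub_sqrt hq).div_const (2 * t)
  have hsum := (hp.integrable.add hq.integrable).const_mul t
  calc ∫ x, |p x - q x| ∂m
      ≤ ∫ x, ((√(p x) - √(q x)) ^ 2 / (2 * t) + t * (p x + q x)) ∂m :=
        integral_mono (hp.integrable.sub hq.integrable).abs (hsqrt.add hsum) fun x =>
          abs_sub_le_sq_sqrt_sub_sqrt (hp.nonneg x) (hq.nonneg x) ht
    _ = _ := by
        rw [integral_add (g := fun x => t * (p x + q x)) hsqrt hsum, integral_div,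
          integral_const_mul, integral_add hp.integrable hq.integrable, hp.integral_eq_one,
          hq.integral_eq_one, hellingerSq,
          integral_eq_lintegral_of_nonneg_ae (.of_forall fun x => sq_nonneg _) (by fun_prop)]
        ring

theorem IsDensity.sq_integral_sub_integral_le {Ω : Type*} [MeasurableSpace Ω] {m : Measure Ω}
    {p q : Ω → ℝ} (hp : IsDensity m p) (hq : IsDensity m q) {φ : Ω → ℝ} (hφ : Measurable φ)
    (hφ1 : ∀ x, |φ x| ≤ 1) :
    (∫ x, φ x ∂densityMeasure m p - ∫ x, φ x ∂densityMeasure m q) ^ 2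
      ≤ 4 * (hellingerSq m p q).toReal := by
  have hmul {r : Ω → ℝ} (hr : IsDensity m r) : Integrable (fun x => r x * φ x) m :=
    hr.integrable.mul_bdd (c := 1) hφ.aestronglyMeasurable (.of_forall hφ1)
  set Δ := ∫ x, φ x ∂densityMeasure m p - ∫ x, φ x ∂densityMeasure m q with hΔ
  have hL1 : |Δ| ≤ ∫ x, |p x - q x| ∂m := by
    rw [hΔ, hp.integral_densityMeasure, hq.integral_densityMeasure,
      ← integral_sub (hmul hp) (hmul hq)]
    refine abs_integral_le_integral_abs.trans (integral_mono ((hmul hp).sub (hmul hq)).abs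
      (hp.integrable.sub hq.integrable).abs fun x => ?_)
    simp only [← sub_mul, abs_mul]
    exact mul_le_of_le_one_right (abs_nonneg _) (hφ1 x)
  rcases (abs_nonneg Δ).eq_or_lt with h | h
  · rw [← sq_abs, ← h, zero_pow two_ne_zero]
    positivity
  · have hle := hL1.trans (hp.integral_abs_sub_le hq (t := |Δ| / 4) (by positivity))
    rw [← sub_le_iff_le_add, le_div_iff₀ (by positivity)] at hle
    rw [← sq_abs]
    linarith

theorem exists_continuous_integral_ne {X : Type*} [MeasurableSpace X] [TopologicalSpace X]
    [BorelSpace X] [HasOuterApproxClosed X] {P Q : Measure X} [IsFiniteMeasure P]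
    [IsFiniteMeasure Q] (h : P ≠ Q) :
    ∃ φ : X → ℝ, Continuous φ ∧ (∀ x, |φ x| ≤ 1) ∧ ∫ x, φ x ∂P ≠ ∫ x, φ x ∂Q := by
  obtain ⟨g, hg⟩ : ∃ g : BoundedContinuousFunction X ℝ, ∫ x, g x ∂P ≠ ∫ x, g x ∂Q := by
    contrapose! h
    exact ext_of_forall_integral_eq_of_IsFiniteMeasure h
  have hpos : 0 < ‖g‖ + 1 := by positivity
  refine ⟨fun x => g x / (‖g‖ + 1), g.continuous.div_const _, fun x => ?_, ?_⟩
  · rw [abs_div, abs_of_pos hpos, div_le_one hpos]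
    exact (g.norm_coe_le_norm x).trans (by linarith)
  · simpa only [integral_div, ne_eq, div_left_inj' hpos.ne'] using hg

theorem integral_densityMeasure_lsDensity (hf : Measurable f) (η : ℝ) {s : ℝ} (hs : 0 < s)
    {φ : ℝ → ℝ} (hφ : Continuous φ) :
    ∫ y, φ y ∂densityMeasure volume (lsDensity f η s)
      = ∫ u, φ (η + s * u) ∂densityMeasure volume f := by
  rw [densityMeasure_lsDensity hf η hs,
    integral_map (by fun_prop) hφ.aestronglyMeasurable]

theorem exists_eventually_const_le_hellingerSq (hf : IsDensity volume f) (hθ₀ : 0 < θ₀.2)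
    (hne : θ₀ ≠ (0, 1)) :
    ∃ c : NNReal, c ≠ 0 ∧
      ∀ᶠ θ in 𝓝 θ₀, c ≤ hellingerSq volume f (lsDensity f θ.1 θ.2) := by
  have := hf.isProbabilityMeasure
  have hf₀ := hf.lsDensity θ₀.1 hθ₀
  have := hf₀.isProbabilityMeasure
  have hatom : NullSingletonClass (densityMeasure volume f) := by
    unfold densityMeasure
    infer_instance
  have hPne : densityMeasure volume f ≠ densityMeasure volume (lsDensity f θ₀.1 θ₀.2) := by
    rw [densityMeasure_lsDensity hf.measurable θ₀.1 hθ₀]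
    exact (map_affine_ne _ hθ₀ hne).symm
  obtain ⟨φ, hφ, hφ1, hφne⟩ := exists_continuous_integral_ne hPne
  rw [integral_densityMeasure_lsDensity hf.measurable θ₀.1 hθ₀ hφ] at hφne
  set Δ : ℝ × ℝ → ℝ := fun θ => ∫ u, φ u ∂densityMeasure volume f
    - ∫ u, φ (θ.1 + θ.2 * u) ∂densityMeasure volume f
  have hΔ : Continuous Δ := continuous_const.sub <| continuous_of_dominated (bound := fun _ => 1)
    (fun θ => (hφ.comp (by fun_prop)).aestronglyMeasurable) (fun θ => .of_forall fun u => hφ1 _)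
    (integrable_const _) (.of_forall fun u => hφ.comp (by fun_prop))
  have hΔ₀ : 0 < Δ θ₀ ^ 2 := by
    have := sub_ne_zero.2 hφne
    positivity
  have hsnd : ∀ᶠ θ : ℝ × ℝ in 𝓝 θ₀, 0 < θ.2 :=
    continuous_snd.continuousAt.eventually_const_lt hθ₀
  refine ⟨(Δ θ₀ ^ 2 / 8).toNNReal, by positivity, ?_⟩
  have hΔ2 : Continuous fun θ => Δ θ ^ 2 := hΔ.pow 2
  filter_upwards [hsnd, hΔ2.continuousAt.eventually_const_lt (half_lt_self hΔ₀)] with θ hθ hlt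
  have hfθ := hf.lsDensity θ.1 hθ
  have hle := hf.sq_integral_sub_integral_le hfθ hφ.measurable hφ1
  rw [integral_densityMeasure_lsDensity hf.measurable θ.1 hθ hφ] at hle
  refine ENNReal.ofReal_le_of_le_toReal ?_
  change Δ θ ^ 2 ≤ _ at hle
  linarith

end LocalBounds

section HellingerDifferentiability

variable {f : ℝ → ℝ} {θ₀ : ℝ × ℝ}

theorem hellingerSq_eq_eLpNorm_sq {Ω : Type*} [MeasurableSpace Ω] (m : Measure Ω) (p q : Ω → ℝ) :
    hellingerSq m p q = eLpNorm (fun x => √(q x) - √(p x)) 2 m ^ 2 := by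
  have h := eLpNorm_nnreal_pow_eq_lintegral (μ := m) (p := 2) (f := fun x => √(q x) - √(p x))
    two_ne_zero
  simp only [NNReal.coe_ofNat, ENNReal.coe_ofNat, ENNReal.rpow_ofNat] at h
  rw [h, hellingerSq]
  refine lintegral_congr fun x => ?_
  rw [← ofReal_norm, ← ENNReal.ofReal_pow (norm_nonneg _), Real.norm_eq_abs, sq_abs, sub_sq_comm]

theorem exists_sqrt_le_mul_eLpNorm {Ω : Type*} [MeasurableSpace Ω] {m : Measure Ω}
    {ξ₁ ξ₂ : Ω → ℝ} (h₁ : MemLp ξ₁ 2 m) (h₂ : MemLp ξ₂ 2 m)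
    (hind : ∀ a b : ℝ, (∀ᵐ x ∂m, a * ξ₁ x + b * ξ₂ x = 0) → a = 0 ∧ b = 0) :
    ∃ K : ℝ, 0 < K ∧ ∀ a b : ℝ,
      √(a ^ 2 + b ^ 2) ≤ K * (eLpNorm (fun x => a * ξ₁ x + b * ξ₂ x) 2 m).toReal := by
  have : Fact ((1 : ENNReal) ≤ 2) := ⟨one_le_two⟩
  let T : WithLp 2 (ℝ × ℝ) →ₗ[ℝ] Lp ℝ 2 m :=
    (LinearMap.fst ℝ ℝ ℝ).smulRight (h₁.toLp ξ₁) ∘ₗ (WithLp.linearEquiv 2 ℝ (ℝ × ℝ)).toLinearMap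
    + (LinearMap.snd ℝ ℝ ℝ).smulRight (h₂.toLp ξ₂) ∘ₗ (WithLp.linearEquiv 2 ℝ (ℝ × ℝ)).toLinearMap
  have hmem (a b : ℝ) : MemLp (fun x => a * ξ₁ x + b * ξ₂ x) 2 m :=
    (h₁.const_mul a).add (h₂.const_mul b)
  have hT (a b : ℝ) : T (WithLp.toLp 2 (a, b)) = (hmem a b).toLp _ := rfl
  have hker : LinearMap.ker T = ⊥ := by
    refine LinearMap.ker_eq_bot'.2 fun v hv => ?_
    obtain ⟨⟨a, b⟩⟩ := v
    rw [hT] at hv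
    obtain ⟨rfl, rfl⟩ := hind a b
      ((hmem a b).coeFn_toLp.symm.trans (Lp.eq_zero_iff_ae_eq_zero.1 hv))
    rfl
  obtain ⟨K, hK, hanti⟩ := T.exists_antilipschitzWith hker
  refine ⟨K, hK, fun a b => ?_⟩
  have h := hanti.le_mul_dist (WithLp.toLp 2 (a, b)) 0
  rw [map_zero, dist_zero_right, dist_zero_right, hT, Lp.norm_toLp,
    WithLp.prod_norm_eq_of_L2] at h
  simpa only [Real.norm_eq_abs, sq_abs, WithLp.toLp_fst, WithLp.toLp_snd] using h

theorem toReal_eLpNorm_le_add_sub {Ω : Type*} [MeasurableSpace Ω] {m : Measure Ω} {u v : Ω → ℝ}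
    (hu : MemLp u 2 m) (hv : MemLp v 2 m) :
    (eLpNorm u 2 m).toReal ≤ (eLpNorm v 2 m).toReal + (eLpNorm (v - u) 2 m).toReal := by
  have : Fact ((1 : ENNReal) ≤ 2) := ⟨one_le_two⟩
  simpa only [← MemLp.toLp_sub, Lp.norm_toLp] using
    norm_le_norm_add_norm_sub (hv.toLp v) (hu.toLp u)

theorem IsDensity.memLp_sqrt {Ω : Type*} [MeasurableSpace Ω] {m : Measure Ω} {p : Ω → ℝ}
    (hp : IsDensity m p) : MemLp (fun x => √(p x)) 2 m := by
  have hpm := hp.measurable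
  rw [memLp_two_iff_integrable_sq (by fun_prop)]
  simpa only [Real.sq_sqrt (hp.nonneg _)] using hp.integrable

theorem exists_eventually_paramSq_le_of_hellingerNondegenerate (hf : IsDensity volume f)
    (hH : HellingerNondegenerate f) : ∃ K : NNReal, ∀ᶠ θ in 𝓝 (0, 1),
      paramSq θ ≤ K * hellingerSq volume f (lsDensity f θ.1 θ.2) := by
  obtain ⟨ξ₁, ξ₂, ⟨h₁, h₂, hsmall⟩, hind⟩ := hH
  obtain ⟨K, hK, hlower⟩ := exists_sqrt_le_mul_eLpNorm h₁ h₂ hind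
  refine ⟨((2 * K) ^ 2).toNNReal, ?_⟩
  have hsnd : ∀ᶠ θ : ℝ × ℝ in 𝓝 (0, 1), 0 < θ.2 :=
    continuous_snd.continuousAt.eventually_const_lt one_pos
  filter_upwards [hsmall.def (show 0 < 1 / (2 * K) by positivity), hsnd] with θ hrem hθ
  set r := √(θ.1 ^ 2 + (θ.2 - 1) ^ 2) with hr
  set G : ℝ → ℝ := fun y => √(lsDensity f θ.1 θ.2 y) - √(lsDensity f 0 1 y) with hG
  set g := (eLpNorm G 2 volume).toReal with hg
  have hGmem : MemLp G 2 volume :=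
    (hf.lsDensity θ.1 hθ).memLp_sqrt.sub (hf.lsDensity 0 one_pos).memLp_sqrt
  set L : ℝ → ℝ := fun y => θ.1 * ξ₁ y + (θ.2 - 1) * ξ₂ y
  have hLmem : MemLp L 2 volume := (h₁.const_mul θ.1).add (h₂.const_mul (θ.2 - 1))
  have htri := mul_le_mul_of_nonneg_left (toReal_eLpNorm_le_add_sub hLmem hGmem) hK.le
  have hrL : r ≤ K * (eLpNorm L 2 volume).toReal := hlower θ.1 (θ.2 - 1)
  have hrg : r ≤ 2 * K * g := by
    rw [Real.norm_of_nonneg ENNReal.toReal_nonneg, Real.norm_of_nonneg (Real.sqrt_nonneg _),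
      one_div_mul_eq_div, le_div_iff₀ (by positivity)] at hrem
    change (eLpNorm (G - L) 2 volume).toReal * (2 * K) ≤ r at hrem
    linarith
  calc paramSq θ = ENNReal.ofReal (r ^ 2) := by
        rw [hr, Real.sq_sqrt (by positivity), sub_sq_comm, paramSq]
    _ ≤ ENNReal.ofReal ((2 * K) ^ 2 * g ^ 2) := by
        rw [← mul_pow]
        gcongr
    _ = ENNReal.ofReal ((2 * K) ^ 2) * hellingerSq volume f (lsDensity f θ.1 θ.2) := by
        rw [ENNReal.ofReal_mul (by positivity), hellingerSq_eq_eLpNorm_sq,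
          ENNReal.ofReal_pow ENNReal.toReal_nonneg, ENNReal.ofReal_toReal hGmem.eLpNorm_ne_top, hG,
          lsDensity_zero_one]

theorem exists_eventually_paramSq_le (hf : IsDensity volume f) (hH : HellingerNondegenerate f)
    (hθ₀ : 0 < θ₀.2) : ∃ K : NNReal, ∀ᶠ θ in 𝓝 θ₀,
      paramSq θ ≤ K * hellingerSq volume f (lsDensity f θ.1 θ.2) := by
  rcases eq_or_ne θ₀ (0, 1) with rfl | hne
  · exact exists_eventually_paramSq_le_of_hellingerNondegenerate hf hH
  · obtain ⟨c, hc, hlower⟩ := exists_eventually_const_le_hellingerSq hf hθ₀ hne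
    obtain ⟨a, ha, -⟩ := ENNReal.lt_iff_exists_nnreal_btwn.1 (paramSq_ne_top θ₀).lt_top
    exact exists_eventually_le_mul_of_le hc
      ((continuous_paramSq.continuousAt.eventually_lt_const ha).mono fun _ => le_of_lt) hlower

end HellingerDifferentiability

section UniformBounds

variable {f : ℝ → ℝ} {σbar : ℝ} {θ θ' : ℝ × ℝ}

/-- The compact set of parameters allowed by the bounds on the regression and scale functions. -/
def paramBox (J σbar : ℝ) : Set (ℝ × ℝ) := Set.Icc (-J) J ×ˢ Set.Icc σbar⁻¹ σbar

theorem snd_pos_of_mem_paramBox {J : ℝ} (hσ : 0 < σbar) (h : θ ∈ paramBox J σbar) : 0 < θ.2 :=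
  (inv_pos.2 hσ).trans_le h.2.1

/-- The squared Euclidean distance of two parameters. -/
noncomputable def paramDistSq (θ θ' : ℝ × ℝ) : ENNReal :=
  ENNReal.ofReal ((θ.1 - θ'.1) ^ 2 + (θ.2 - θ'.2) ^ 2)

theorem ofReal_sq_mul_paramSq_relParam (hθ : 0 < θ.2) (θ' : ℝ × ℝ) :
    ENNReal.ofReal (θ.2 ^ 2) * paramSq (relParam θ θ') = paramDistSq θ θ' := by
  rw [paramSq, paramDistSq, ← ENNReal.ofReal_mul (sq_nonneg _), relParam]
  congr 1
  field_simp
  ring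

theorem exists_relParam_le_of_forall_exists_eventually {g r : ℝ × ℝ → ENNReal}
    (h : ∀ θ₀ : ℝ × ℝ, 0 < θ₀.2 → ∃ K : NNReal, ∀ᶠ θ in 𝓝 θ₀, g θ ≤ K * r θ) (J : ℝ)
    (hσ : 0 < σbar) :
    ∃ K : NNReal, ∀ θ ∈ paramBox J σbar, ∀ θ' ∈ paramBox J σbar,
      g (relParam θ θ') ≤ K * r (relParam θ θ') := by
  have hbox : IsCompact (paramBox J σbar) := isCompact_Icc.prod isCompact_Icc
  obtain ⟨K, hK⟩ := exists_le_mul_of_isCompact (hbox.prod hbox)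
    (g := fun z : (ℝ × ℝ) × ℝ × ℝ => g (relParam z.1 z.2))
    (r := fun z => r (relParam z.1 z.2)) fun z hz => by
      have hpos := snd_pos_of_mem_paramBox hσ hz.1
      have hcont : ContinuousAt (fun z : (ℝ × ℝ) × ℝ × ℝ => relParam z.1 z.2) z := by
        unfold relParam
        fun_prop (disch := exact hpos.ne')
      obtain ⟨K, hK⟩ := h _ (relParam_snd_pos hpos (snd_pos_of_mem_paramBox hσ hz.2))
      exact ⟨K, hcont.eventually hK⟩
  exact ⟨K, fun θ hθ θ' hθ' => hK (θ, θ') ⟨hθ, hθ'⟩⟩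

theorem exists_klDiv_lsDensity_le (hf : IsDensity volume f) (hKL : KLFiniteContinuous f)
    (hloc : KLLocallyQuadratic f) (J : ℝ) (hσ : 0 < σbar) :
    ∃ K : NNReal, ∀ θ ∈ paramBox J σbar, ∀ θ' ∈ paramBox J σbar,
      klDiv (densityMeasure volume (lsDensity f θ.1 θ.2))
        (densityMeasure volume (lsDensity f θ'.1 θ'.2)) ≤ K * paramDistSq θ θ' := by
  obtain ⟨K, hK⟩ := exists_relParam_le_of_forall_exists_eventually
    (fun θ₀ hθ₀ => exists_eventually_lsKL_le hKL hloc hθ₀) J hσ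
  refine ⟨K * (σbar ^ 2).toNNReal, fun θ hθ θ' hθ' => ?_⟩
  have hpos := snd_pos_of_mem_paramBox hσ hθ
  have hle : paramSq (relParam θ θ') ≤ ENNReal.ofReal (σbar ^ 2) * paramDistSq θ θ' := by
    rw [← ofReal_sq_mul_paramSq_relParam hpos, ← mul_assoc, ← ENNReal.ofReal_mul (sq_nonneg _)]
    refine le_mul_of_one_le_left zero_le (ENNReal.one_le_ofReal.2 ?_)
    rw [← mul_pow]
    exact one_le_pow₀ ((inv_le_iff_one_le_mul₀' hσ).1 hθ.2.1)
  rw [klDiv_lsDensity hf hpos (snd_pos_of_mem_paramBox hσ hθ'), ENNReal.coe_mul, mul_assoc]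
  exact (hK θ hθ θ' hθ').trans (by gcongr; exact hle)

theorem exists_paramDistSq_le_hellingerSq (hf : IsDensity volume f) (hH : HellingerNondegenerate f)
    (J : ℝ) (hσ : 0 < σbar) :
    ∃ K : NNReal, ∀ θ ∈ paramBox J σbar, ∀ θ' ∈ paramBox J σbar,
      paramDistSq θ θ'
        ≤ K * hellingerSq volume (lsDensity f θ.1 θ.2) (lsDensity f θ'.1 θ'.2) := by
  obtain ⟨K, hK⟩ := exists_relParam_le_of_forall_exists_eventually
    (fun θ₀ hθ₀ => exists_eventually_paramSq_le hf hH hθ₀) J hσ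
  refine ⟨(σbar ^ 2).toNNReal * K, fun θ hθ θ' hθ' => ?_⟩
  have hpos := snd_pos_of_mem_paramBox hσ hθ
  rw [← ofReal_sq_mul_paramSq_relParam hpos, hellingerSq_lsDensity hf.measurable hpos,
    ENNReal.coe_mul, mul_assoc]
  refine mul_le_mul' (ENNReal.ofReal_le_ofReal ?_) (hK θ hθ θ' hθ')
  exact pow_le_pow_left₀ hpos.le hθ.2.2 2

end UniformBounds

section SqDist

variable {𝒳 : Type*} [MeasurableSpace 𝒳] {ν : Measure 𝒳} {h u v w : 𝒳 → ℝ}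

theorem sqDist_self (ν : Measure 𝒳) (h u : 𝒳 → ℝ) : sqDist ν h u u = 0 := by simp [sqDist]

theorem sqDist_comm (ν : Measure 𝒳) (h u v : 𝒳 → ℝ) : sqDist ν h u v = sqDist ν h v u := by
  simp only [sqDist, sub_sq_comm]

theorem sqDist_eq_lintegral (hh : IsDensity ν h) (hu : Measurable u) (hv : Measurable v) :
    sqDist ν h u v = ∫⁻ x, ENNReal.ofReal ((u x - v x) ^ 2) ∂densityMeasure ν h := by
  rw [lintegral_densityMeasure hh.measurable (by fun_prop), sqDist]
  exact lintegral_congr fun x => by rw [mul_comm, ENNReal.ofReal_mul (hh.nonneg x)]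

theorem sqDist_le_add (hh : IsDensity ν h) (hu : Measurable u) (hv : Measurable v)
    (hw : Measurable w) : sqDist ν h u v ≤ 2 * (sqDist ν h u w + sqDist ν h w v) := by
  rw [sqDist_eq_lintegral hh hu hv, sqDist_eq_lintegral hh hu hw, sqDist_eq_lintegral hh hw hv,
    ← lintegral_add_left (by fun_prop), ← lintegral_const_mul _ (by fun_prop)]
  refine lintegral_mono fun x => ?_
  rw [← ENNReal.ofReal_add (by positivity) (by positivity), ← ENNReal.ofReal_ofNat 2,
    ← ENNReal.ofReal_mul zero_le_two]
  refine ENNReal.ofReal_le_ofReal ?_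
  simpa only [sub_add_sub_cancel] using add_sq_le (a := u x - w x) (b := w x - v x)

theorem sqDist_le_mul {h₀ : 𝒳 → ℝ} {C : ℝ} (hh₀ : IsDensity ν h₀) (hu : Measurable u)
    (hv : Measurable v) (hle : ∀ x, h x ≤ C * h₀ x) :
    sqDist ν h u v ≤ ENNReal.ofReal C * sqDist ν h₀ u v := by
  have hhm := hh₀.measurable
  unfold sqDist
  rw [← lintegral_const_mul _ (by fun_prop)]
  refine lintegral_mono fun x => ?_
  rw [← ENNReal.ofReal_mul' (mul_nonneg (sq_nonneg _) (hh₀.nonneg x)), mul_left_comm]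
  gcongr
  exact hle x

theorem measurable_sqDist_uncurry {Z : Type*} [MeasurableSpace Z] {est : Z → 𝒳 → ℝ} [SFinite ν]
    (hh : Measurable h) (hu : Measurable u) (hest : Measurable (Function.uncurry est)) :
    Measurable fun z => sqDist ν h u (est z) := by
  have hest' : Measurable fun z : Z × 𝒳 => est z.1 z.2 := hest
  exact Measurable.lintegral_prod_right'
    (f := fun z : Z × 𝒳 => ENNReal.ofReal ((u z.2 - est z.1 z.2) ^ 2 * h z.2)) (by fun_prop)

end SqDist

section Model

variable {𝒳 : Type*} [MeasurableSpace 𝒳] {ν : Measure 𝒳} {f : ℝ → ℝ} {h : 𝒳 → ℝ}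
  {φ ψ : 𝒳 → ℝ × ℝ}

/-- The conditional density of the response given the covariate, when the location and the scale
at `x` are the two components of `φ x`. -/
noncomputable def condDensity (f : ℝ → ℝ) (φ : 𝒳 → ℝ × ℝ) (z : 𝒳 × ℝ) : ℝ :=
  lsDensity f (φ z.1).1 (φ z.1).2 z.2

/-- The reference measure for one observation. It contains the design density, so that the density
of an observation is the conditional density of the response. -/
noncomputable def baseMeasure (ν : Measure 𝒳) (h : 𝒳 → ℝ) : Measure (𝒳 × ℝ) :=
  (densityMeasure ν h).prod volume

theorem measurable_condDensity (hf : Measurable f) (hφ : Measurable φ) :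
    Measurable (condDensity f φ) := by
  unfold condDensity lsDensity
  fun_prop

theorem lintegral_baseMeasure (ν : Measure 𝒳) (h : 𝒳 → ℝ) {F : 𝒳 × ℝ → ENNReal}
    (hF : Measurable F) :
    ∫⁻ z, F z ∂baseMeasure ν h = ∫⁻ x, (∫⁻ y, F (x, y)) ∂densityMeasure ν h :=
  lintegral_prod _ hF.aemeasurable

theorem IsDensity.sigmaFinite_baseMeasure (hh : IsDensity ν h) :
    SigmaFinite (baseMeasure ν h) := by
  have := hh.isProbabilityMeasure
  unfold baseMeasure
  infer_instance

theorem IsDensity.condDensity (hf : IsDensity volume f) (hh : IsDensity ν h)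
    (hφ : Measurable φ) (hpos : ∀ x, 0 < (φ x).2) :
    IsDensity (baseMeasure ν h) (condDensity f φ) where
  measurable := measurable_condDensity hf.measurable hφ
  nonneg z := (hf.lsDensity _ (hpos z.1)).nonneg _
  lintegral_eq_one := by
    have := hh.isProbabilityMeasure
    have hm := measurable_condDensity hf.measurable hφ
    rw [lintegral_baseMeasure ν h (by fun_prop)]
    simp only [LocScale.condDensity, (hf.lsDensity _ (hpos _)).lintegral_eq_one, lintegral_one,
      measure_univ]

theorem obsLaw_eq_densityMeasure (hf : IsDensity volume f) (hφ : Measurable φ)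
    (hpos : ∀ x, 0 < (φ x).2) :
    obsLaw ν f (fun x => (φ x).1) (fun x => (φ x).2) h
      = densityMeasure (baseMeasure ν h) (condDensity f φ) := by
  have := hf.isProbabilityMeasure
  have hm := measurable_condDensity hf.measurable hφ
  refine Measure.ext_of_lintegral _ fun F hF => ?_
  rw [obsLaw, lintegral_map hF (by fun_prop),
    lintegral_prod _ (Measurable.aemeasurable (by fun_prop)), lintegral_densityMeasure hm hF,
    lintegral_baseMeasure ν h (by fun_prop)]
  refine lintegral_congr fun x => ?_
  have hmx := measurable_lsDensity hf.measurable (φ x).1 (φ x).2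
  simp only [condDensity]
  rw [← lintegral_densityMeasure hmx (F := fun y => F (x, y)) (by fun_prop),
    densityMeasure_lsDensity hf.measurable _ (hpos x), lintegral_map (by fun_prop) (by fun_prop)]

theorem klDiv_condDensity (hf : IsDensity volume f) (hh : IsDensity ν h) (hφ : Measurable φ)
    (hψ : Measurable ψ) (hφpos : ∀ x, 0 < (φ x).2) (hψpos : ∀ x, 0 < (ψ x).2) :
    klDiv (densityMeasure (baseMeasure ν h) (condDensity f φ))
        (densityMeasure (baseMeasure ν h) (condDensity f ψ))
      = ∫⁻ x, klDiv (densityMeasure volume (lsDensity f (φ x).1 (φ x).2))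
          (densityMeasure volume (lsDensity f (ψ x).1 (ψ x).2)) ∂densityMeasure ν h := by
  have hφd := hf.condDensity hh hφ hφpos
  have hψd := hf.condDensity hh hψ hψpos
  have hm : Measurable fun z => klTerm (condDensity f φ z) (condDensity f ψ z) :=
    measurable_klTerm.comp (hφd.measurable.prodMk hψd.measurable)
  rw [hφd.klDiv_eq_lintegral_klTerm hψd, lintegral_baseMeasure ν h hm]
  refine lintegral_congr fun x => Eq.symm ?_
  exact (hf.lsDensity _ (hφpos x)).klDiv_eq_lintegral_klTerm (hf.lsDensity _ (hψpos x))

theorem hellingerSq_condDensity (hf : Measurable f) (hφ : Measurable φ) (hψ : Measurable ψ) :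
    hellingerSq (baseMeasure ν h) (condDensity f φ) (condDensity f ψ)
      = ∫⁻ x, hellingerSq volume (lsDensity f (φ x).1 (φ x).2) (lsDensity f (ψ x).1 (ψ x).2)
          ∂densityMeasure ν h := by
  have hφm := measurable_condDensity hf hφ
  have hψm := measurable_condDensity hf hψ
  rw [hellingerSq, lintegral_baseMeasure ν h (by fun_prop)]
  rfl

theorem lintegral_paramDistSq (hh : IsDensity ν h) (hφ : Measurable φ) (hψ : Measurable ψ) :
    ∫⁻ x, paramDistSq (φ x) (ψ x) ∂densityMeasure ν h
      = sqDist ν h (fun x => (φ x).1) (fun x => (ψ x).1)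
        + sqDist ν h (fun x => (φ x).2) (fun x => (ψ x).2) := by
  rw [sqDist_eq_lintegral hh (by fun_prop) (by fun_prop),
    sqDist_eq_lintegral hh (by fun_prop) (by fun_prop), ← lintegral_add_left (by fun_prop)]
  exact lintegral_congr fun x => ENNReal.ofReal_add (sq_nonneg _) (sq_nonneg _)

end Model

section ModelBounds

variable {𝒳 : Type*} [MeasurableSpace 𝒳] {ν : Measure 𝒳} {f : ℝ → ℝ} {h : 𝒳 → ℝ}
  {φ ψ : 𝒳 → ℝ × ℝ} {K : NNReal}

theorem klDiv_condDensity_le (hf : IsDensity volume f) (hh : IsDensity ν h) (hφ : Measurable φ)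
    (hψ : Measurable ψ) (hφpos : ∀ x, 0 < (φ x).2) (hψpos : ∀ x, 0 < (ψ x).2)
    (hle : ∀ x, klDiv (densityMeasure volume (lsDensity f (φ x).1 (φ x).2))
      (densityMeasure volume (lsDensity f (ψ x).1 (ψ x).2)) ≤ K * paramDistSq (φ x) (ψ x)) :
    klDiv (densityMeasure (baseMeasure ν h) (condDensity f φ))
        (densityMeasure (baseMeasure ν h) (condDensity f ψ))
      ≤ K * (sqDist ν h (fun x => (φ x).1) (fun x => (ψ x).1)
        + sqDist ν h (fun x => (φ x).2) (fun x => (ψ x).2)) := by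
  rw [klDiv_condDensity hf hh hφ hψ hφpos hψpos, ← lintegral_paramDistSq hh hφ hψ,
    ← lintegral_const_mul' _ _ ENNReal.coe_ne_top]
  exact lintegral_mono hle

theorem sqDist_le_mul_hellingerSq_condDensity (hf : Measurable f) (hh : IsDensity ν h)
    (hφ : Measurable φ) (hψ : Measurable ψ)
    (hle : ∀ x, paramDistSq (φ x) (ψ x)
      ≤ K * hellingerSq volume (lsDensity f (φ x).1 (φ x).2) (lsDensity f (ψ x).1 (ψ x).2)) :
    sqDist ν h (fun x => (φ x).1) (fun x => (ψ x).1)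
      ≤ K * hellingerSq (baseMeasure ν h) (condDensity f φ) (condDensity f ψ) := by
  calc sqDist ν h (fun x => (φ x).1) (fun x => (ψ x).1)
      ≤ ∫⁻ x, paramDistSq (φ x) (ψ x) ∂densityMeasure ν h := by
        rw [lintegral_paramDistSq hh hφ hψ]
        exact le_self_add
    _ ≤ K * hellingerSq (baseMeasure ν h) (condDensity f φ) (condDensity f ψ) := by
        rw [hellingerSq_condDensity hf hφ hψ, ← lintegral_const_mul' _ _ ENNReal.coe_ne_top]
        exact lintegral_mono hle

end ModelBounds

section Packing

variable {𝒳 : Type*} [MeasurableSpace 𝒳] {ν : Measure 𝒳} {h : 𝒳 → ℝ} {V : Set (𝒳 → ℝ)}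
  {ε L : ℝ} {N : Finset (𝒳 → ℝ)}

theorem IsPacking.log_card_le (hN : IsPacking ν h V ε N) (hL : 0 ≤ L)
    (hle : packingEntropy ν h V ε ≤ ENNReal.ofReal L) : Real.log N.card ≤ L :=
  (ENNReal.ofReal_le_ofReal_iff hL).1 <| (le_iSup₂ (f := fun (N : Finset (𝒳 → ℝ))
    (_ : IsPacking ν h V ε N) => ENNReal.ofReal (Real.log N.card)) N hN).trans hle

theorem isPacking_empty : IsPacking ν h V ε ∅ := by simp [IsPacking]

theorem IsPacking.insert [DecidableEq (𝒳 → ℝ)] {u : 𝒳 → ℝ} (hN : IsPacking ν h V ε N)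
    (hu : u ∈ V) (hfar : ∀ v ∈ N, ENNReal.ofReal (ε ^ 2) < sqDist ν h u v) :
    IsPacking ν h V ε (insert u N) := by
  refine ⟨by simpa [hu] using hN.1, fun v hv w hw hne => ?_⟩
  rcases Finset.mem_insert.1 hv with rfl | hvN <;> rcases Finset.mem_insert.1 hw with rfl | hwN
  · exact absurd rfl hne
  · exact hfar w hwN
  · exact sqDist_comm ν h w v ▸ hfar v hvN
  · exact hN.2 v hvN w hwN hne

theorem exists_isPacking_card_maximal (hL : 0 ≤ L)
    (hle : packingEntropy ν h V ε ≤ ENNReal.ofReal L) :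
    ∃ N, IsPacking ν h V ε N ∧ ∀ N', IsPacking ν h V ε N' → N'.card ≤ N.card := by
  have hbdd : BddAbove (Finset.card '' {N | IsPacking ν h V ε N}) := by
    refine ⟨⌊Real.exp L⌋₊, ?_⟩
    rintro _ ⟨N, hN, rfl⟩
    refine Nat.le_floor ((Real.le_exp_log _).trans ?_)
    exact Real.exp_le_exp.2 (hN.log_card_le hL hle)
  obtain ⟨N, hN, hcard⟩ := Nat.sSup_mem (Set.Nonempty.image _ ⟨∅, isPacking_empty⟩) hbdd
  exact ⟨N, hN, fun N' hN' => hcard ▸ le_csSup hbdd ⟨N', hN', rfl⟩⟩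

theorem exists_isPacking_cover (hL : 0 ≤ L) (hle : packingEntropy ν h V ε ≤ ENNReal.ofReal L) :
    ∃ N, IsPacking ν h V ε N ∧ ∀ u ∈ V, ∃ v ∈ N, sqDist ν h u v ≤ ENNReal.ofReal (ε ^ 2) := by
  classical
  obtain ⟨N, hN, hmax⟩ := exists_isPacking_card_maximal hL hle
  refine ⟨N, hN, fun u hu => ?_⟩
  by_contra! hfar
  have hnot : u ∉ N := fun hmem => by simpa [sqDist_self] using hfar u hmem
  have hcard := hmax _ (hN.insert hu hfar)
  rw [Finset.card_insert_of_notMem hnot] at hcard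
  omega

theorem exists_cover_of_packingEntropy_le {r b m : ℝ} (hm : 0 ≤ m)
    (hent : packingEntropy ν h V r ≤ ENNReal.ofReal (b * m)) :
    ∃ N : Finset (𝒳 → ℝ), (∀ u ∈ N, u ∈ V) ∧
      (∀ u ∈ V, ∃ v ∈ N, sqDist ν h u v ≤ ENNReal.ofReal (r ^ 2)) ∧
        Real.log N.card ≤ |b| * m := by
  have hle : packingEntropy ν h V r ≤ ENNReal.ofReal (|b| * m) :=
    hent.trans (ENNReal.ofReal_le_ofReal (mul_le_mul_of_nonneg_right (le_abs_self b) hm))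
  obtain ⟨N, hN, hcov⟩ := exists_isPacking_cover (by positivity) hle
  exact ⟨N, hN.1, hcov, hN.log_card_le (by positivity) hle⟩

theorem exists_isPacking_lt_log_card (hL : 0 ≤ L)
    (hlt : ENNReal.ofReal L < packingEntropy ν h V ε) :
    ∃ N, IsPacking ν h V ε N ∧ L < Real.log N.card := by
  obtain ⟨N, hN⟩ := lt_iSup_iff.1 hlt
  obtain ⟨hpack, hlog⟩ := lt_iSup_iff.1 hN
  exact ⟨N, hpack, (ENNReal.ofReal_lt_ofReal_iff_of_nonneg hL).1 hlog⟩

theorem IsPacking.pairwiseDisjoint_ball {Z : Type*} {g : Z → 𝒳 → ℝ} (hh : IsDensity ν h)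
    (hV : ∀ u ∈ V, Measurable u) (hg : ∀ z, Measurable (g z)) (hN : IsPacking ν h V ε N) :
    (N : Set (𝒳 → ℝ)).PairwiseDisjoint
      fun u => {z | sqDist ν h u (g z) < ENNReal.ofReal (ε ^ 2 / 4)} := by
  intro u hu v hv hne
  refine Set.disjoint_left.2 fun z hzu hzv => lt_irrefl (ENNReal.ofReal (ε ^ 2)) ?_
  calc ENNReal.ofReal (ε ^ 2) < sqDist ν h u v := hN.2 u hu v hv hne
    _ ≤ 2 * (sqDist ν h u (g z) + sqDist ν h (g z) v) :=
      sqDist_le_add hh (hV u (hN.1 u hu)) (hV v (hN.1 v hv)) (hg z)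
    _ ≤ 2 * (ENNReal.ofReal (ε ^ 2 / 4) + ENNReal.ofReal (ε ^ 2 / 4)) := by
      rw [sqDist_comm ν h (g z) v]
      gcongr
      · exact le_of_lt hzu
      · exact le_of_lt hzv
    _ = ENNReal.ofReal (ε ^ 2) := by
      rw [← ENNReal.ofReal_add (by positivity) (by positivity), ← ENNReal.ofReal_ofNat 2,
        ← ENNReal.ofReal_mul zero_le_two]
      ring_nf

end Packing

/-- On the parameter set `B`, the Kullback-Leibler divergence between members of the
location-scale family is at most of the order of the squared distance of the parameters, and the
squared Hellinger distance is at least of that order. -/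
structure IsComparableOn (f : ℝ → ℝ) (B : Set (ℝ × ℝ)) (K L : NNReal) : Prop where
  snd_pos {θ : ℝ × ℝ} (hθ : θ ∈ B) : 0 < θ.2
  klDiv_le {θ θ' : ℝ × ℝ} (hθ : θ ∈ B) (hθ' : θ' ∈ B) :
    klDiv (densityMeasure volume (lsDensity f θ.1 θ.2))
      (densityMeasure volume (lsDensity f θ'.1 θ'.2)) ≤ K * paramDistSq θ θ'
  le_hellingerSq {θ θ' : ℝ × ℝ} (hθ : θ ∈ B) (hθ' : θ' ∈ B) :
    paramDistSq θ θ' ≤ L * hellingerSq volume (lsDensity f θ.1 θ.2) (lsDensity f θ'.1 θ'.2)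

theorem exists_isComparableOn_paramBox {f : ℝ → ℝ} (hf : IsDensity volume f)
    (hKL : KLFiniteContinuous f) (hloc : KLLocallyQuadratic f) (hH : HellingerNondegenerate f)
    (J : ℝ) {σbar : ℝ} (hσ : 0 < σbar) : ∃ K L, IsComparableOn f (paramBox J σbar) K L := by
  obtain ⟨K, hK⟩ := exists_klDiv_lsDensity_le hf hKL hloc J hσ
  obtain ⟨L, hL⟩ := exists_paramDistSq_le_hellingerSq hf hH J hσ
  exact ⟨K, L, snd_pos_of_mem_paramBox hσ, fun hθ => hK _ hθ _, fun hθ => hL _ hθ _⟩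

section UpperBound

theorem exists_measurable_argmax {ι Z : Type*} [Finite ι] [Nonempty ι] [MeasurableSpace ι]
    [MeasurableSpace Z] {ℓ : ι → Z → ℝ} (hℓ : ∀ i, Measurable (ℓ i)) :
    ∃ j : Z → ι, Measurable j ∧ ∀ z i, ℓ i z ≤ ℓ (j z) z := by
  classical
  obtain ⟨g, hg⟩ := exists_surjective_nat ι
  have hmax : ∀ z, ∃ k, ∀ i, ℓ i z ≤ ℓ (g k) z := fun z => by
    obtain ⟨i₀, hi₀⟩ := Finite.exists_max fun i => ℓ i z
    obtain ⟨k, rfl⟩ := hg i₀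
    exact ⟨k, hi₀⟩
  refine ⟨fun z => g (Nat.find (hmax z)), ?_, fun z => Nat.find_spec (hmax z)⟩
  refine measurable_from_nat.comp (measurable_find hmax fun k => ?_)
  simp only [Set.ofPred_forall]
  exact MeasurableSet.iInter fun i => measurableSet_le (hℓ i) (hℓ (g k))

variable {𝒳 : Type*} [MeasurableSpace 𝒳] {ν : Measure 𝒳} {f : ℝ → ℝ}

theorem exists_likelihood_maximizer {ι : Type*} [Finite ι] [Nonempty ι] {ψ : ι → 𝒳 → ℝ × ℝ}
    (hf : Measurable f) (hψ : ∀ i, Measurable (ψ i)) (n : ℕ) :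
    ∃ j : (Fin n → 𝒳 × ℝ) → ι, Measurable (Function.uncurry fun z x => (ψ (j z) x).1) ∧
      ∀ z i, prodDensity (condDensity f (ψ i)) z ≤ prodDensity (condDensity f (ψ (j z))) z := by
  let _ : MeasurableSpace ι := ⊤
  obtain ⟨j, hj, hmax⟩ := exists_measurable_argmax fun i =>
    measurable_prodDensity (ι := Fin n) (measurable_condDensity hf (hψ i))
  have hloc : Measurable fun p : ι × 𝒳 => (ψ p.1 p.2).1 :=
    measurable_from_prod_countable_right fun i => (hψ i).fst
  exact ⟨j, hloc.comp (hj.prodMap measurable_id), hmax⟩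

variable {B : Set (ℝ × ℝ)} {K L : NNReal}

theorem mul_risk_le_of_likelihood_le {ι : Type*} [Fintype ι] {h : 𝒳 → ℝ} {φ : 𝒳 → ℝ × ℝ}
    {ψ : ι → 𝒳 → ℝ × ℝ} {n : ℕ} {j : (Fin n → 𝒳 × ℝ) → ι}
    (hf : IsDensity volume f) (hfB : IsComparableOn f B K L) (hh : IsDensity ν h)
    (hφ : Measurable φ) (hφB : ∀ x, φ x ∈ B) (hψ : ∀ i, Measurable (ψ i))
    (hψB : ∀ i x, ψ i x ∈ B)
    (hj : ∀ z i, prodDensity (condDensity f (ψ i)) z ≤ prodDensity (condDensity f (ψ (j z))) z)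
    (i : ι) :
    n * risk ν f (fun z x => (ψ (j z) x).1) (fun x => (φ x).1) (fun x => (φ x).2) h
      ≤ L * (2 * ENNReal.ofReal (Real.log (Fintype.card ι))
        + n * (K * (sqDist ν h (fun x => (φ x).1) (fun x => (ψ i x).1)
          + sqDist ν h (fun x => (φ x).2) (fun x => (ψ i x).2)))) := by
  have := hh.sigmaFinite_baseMeasure
  have hφpos : ∀ x, 0 < (φ x).2 := fun x => hfB.snd_pos (hφB x)
  have hψpos : ∀ i x, 0 < (ψ i x).2 := fun i x => hfB.snd_pos (hψB i x)
  set P := Measure.pi fun _ : Fin n => densityMeasure (baseMeasure ν h) (condDensity f φ)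
  rw [risk, obsLaw_eq_densityMeasure hf hφ hφpos]
  calc n * ∫⁻ z, sqDist ν h (fun x => (φ x).1) (fun x => (ψ (j z) x).1) ∂P
      ≤ n * ∫⁻ z, L * hellingerSq (baseMeasure ν h) (condDensity f φ) (condDensity f (ψ (j z)))
          ∂P := by
        gcongr with z
        exact sqDist_le_mul_hellingerSq_condDensity hf.measurable hh hφ (hψ _)
          fun x => hfB.le_hellingerSq (hφB x) (hψB _ x)
    _ = L * (n * ∫⁻ z, hellingerSq (baseMeasure ν h) (condDensity f φ)
          (condDensity f (ψ (j z))) ∂P) := by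
        rw [lintegral_const_mul' _ _ ENNReal.coe_ne_top, mul_left_comm]
    _ ≤ L * (2 * ENNReal.ofReal (Real.log (Fintype.card ι))
        + n * klDiv (densityMeasure (baseMeasure ν h) (condDensity f φ))
          (densityMeasure (baseMeasure ν h) (condDensity f (ψ i)))) := by
        gcongr
        exact lintegral_hellingerSq_le_of_likelihood_le (hf.condDensity hh hφ hφpos)
          (fun i => hf.condDensity hh (hψ i) (hψpos i)) hj i
    _ ≤ _ := by
        gcongr
        exact klDiv_condDensity_le hf hh hφ (hψ i) hφpos (hψpos i)
          fun x => hfB.klDiv_le (hφB x) (hψB i x)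

theorem exists_estimator_mul_risk_le_of_cover {U S H : Set (𝒳 → ℝ)} {h₀ : 𝒳 → ℝ} {C : ℝ}
    {NU NS : Finset (𝒳 → ℝ)} {r : ENNReal}
    (hf : IsDensity volume f) (hfB : IsComparableOn f B K L) (hUm : ∀ μ ∈ U, Measurable μ)
    (hSm : ∀ σ ∈ S, Measurable σ) (hH : ∀ h ∈ H, IsDensity ν h)
    (hB : ∀ μ ∈ U, ∀ σ ∈ S, ∀ x, (μ x, σ x) ∈ B)
    (hh₀ : IsDensity ν h₀) (hdom : ∀ h ∈ H, ∀ x, h x ≤ C * h₀ x)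
    (hNU : ∀ u ∈ NU, u ∈ U) (hNS : ∀ u ∈ NS, u ∈ S)
    (hcovU : ∀ u ∈ U, ∃ v ∈ NU, sqDist ν h₀ u v ≤ r)
    (hcovS : ∀ u ∈ S, ∃ v ∈ NS, sqDist ν h₀ u v ≤ r) (n : ℕ) :
    ∃ est : (Fin n → 𝒳 × ℝ) → 𝒳 → ℝ, Measurable (Function.uncurry est) ∧
      ∀ μ ∈ U, ∀ σ ∈ S, ∀ h ∈ H, n * risk ν f est μ σ h
        ≤ L * (2 * ENNReal.ofReal (Real.log NU.card + Real.log NS.card)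
          + n * (K * (ENNReal.ofReal C * r + ENNReal.ofReal C * r))) := by
  let ψ : NU × NS → 𝒳 → ℝ × ℝ := fun i x => (i.1.1 x, i.2.1 x)
  have hψ : ∀ i, Measurable (ψ i) := fun i =>
    (hUm _ (hNU _ i.1.2)).prodMk (hSm _ (hNS _ i.2.2))
  rcases isEmpty_or_nonempty (NU × NS) with hempty | hne
  · refine ⟨fun _ _ => 0, measurable_const, fun μ hμ σ hσ => ?_⟩
    obtain ⟨u, hu, -⟩ := hcovU μ hμ
    obtain ⟨v, hv, -⟩ := hcovS σ hσ
    exact (hempty.false (⟨u, hu⟩, ⟨v, hv⟩)).elim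
  obtain ⟨j, hj, hmax⟩ := exists_likelihood_maximizer hf.measurable hψ n
  refine ⟨fun z x => (ψ (j z) x).1, hj, fun μ hμ σ hσ h hh => ?_⟩
  obtain ⟨u, hu, hur⟩ := hcovU μ hμ
  obtain ⟨v, hv, hvr⟩ := hcovS σ hσ
  calc n * risk ν f (fun z x => (ψ (j z) x).1) μ σ h
      ≤ L * (2 * ENNReal.ofReal (Real.log (Fintype.card (NU × NS)))
        + n * (K * (sqDist ν h μ u + sqDist ν h σ v))) :=
        mul_risk_le_of_likelihood_le hf hfB (hH h hh) ((hUm μ hμ).prodMk (hSm σ hσ))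
          (hB μ hμ σ hσ) hψ (fun i => hB _ (hNU _ i.1.2) _ (hNS _ i.2.2)) hmax (⟨u, hu⟩, ⟨v, hv⟩)
    _ ≤ L * (2 * ENNReal.ofReal (Real.log NU.card + Real.log NS.card)
        + n * (K * (ENNReal.ofReal C * r + ENNReal.ofReal C * r))) := by
        rw [Fintype.card_prod, Fintype.card_coe, Fintype.card_coe, Nat.cast_mul,
          Real.log_mul (by exact_mod_cast Finset.card_ne_zero_of_mem hu)
            (by exact_mod_cast Finset.card_ne_zero_of_mem hv)]
        gcongr
        · exact (sqDist_le_mul hh₀ (hUm μ hμ) (hUm u (hNU u hu)) (hdom h hh)).trans (by gcongr)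
        · exact (sqDist_le_mul hh₀ (hSm σ hσ) (hSm v (hNS v hv)) (hdom h hh)).trans (by gcongr)

theorem minimaxRisk_le_of_mul_risk_le {U S H : Set (𝒳 → ℝ)} {n : ℕ}
    {est : (Fin n → 𝒳 × ℝ) → 𝒳 → ℝ} {R : ENNReal} (hn : n ≠ 0)
    (hest : Measurable (Function.uncurry est))
    (hle : ∀ μ ∈ U, ∀ σ ∈ S, ∀ h ∈ H, n * risk ν f est μ σ h ≤ n * R) :
    minimaxRisk ν f U S H n ≤ R := by
  refine (iInf₂_le est hest).trans <| iSup₂_le fun μ hμ => iSup₂_le fun σ hσ =>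
    iSup₂_le fun h hh => ?_
  exact (ENNReal.mul_le_mul_iff_right (by exact_mod_cast hn) (ENNReal.natCast_ne_top n)).1
    (hle μ hμ σ hσ h hh)

end UpperBound

section LowerBound

variable {𝒳 : Type*} [MeasurableSpace 𝒳] {ν : Measure 𝒳} {f : ℝ → ℝ} {U S H : Set (𝒳 → ℝ)}
  {μ σ h : 𝒳 → ℝ} {n : ℕ} {est : (Fin n → 𝒳 × ℝ) → 𝒳 → ℝ}

theorem le_minimaxRisk_of_forall_exists_le {R : ENNReal}
    (hle : ∀ est : (Fin n → 𝒳 × ℝ) → 𝒳 → ℝ, Measurable (Function.uncurry est) →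
      ∃ μ ∈ U, ∃ σ ∈ S, ∃ h ∈ H, R ≤ risk ν f est μ σ h) :
    R ≤ minimaxRisk ν f U S H n := by
  refine le_iInf₂ fun est hest => ?_
  obtain ⟨μ, hμ, σ, hσ, h, hh, hR⟩ := hle est hest
  exact hR.trans (le_iSup₂_of_le μ hμ (le_iSup₂_of_le σ hσ (le_iSup₂_of_le h hh le_rfl)))

theorem isProbabilityMeasure_obsLaw (hf : IsDensity volume f) (hh : IsDensity ν h)
    (hμ : Measurable μ) (hσ : Measurable σ) : IsProbabilityMeasure (obsLaw ν f μ σ h) := by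
  have := hf.isProbabilityMeasure
  have := hh.isProbabilityMeasure
  exact Measure.isProbabilityMeasure_map (Measurable.aemeasurable (by fun_prop))

theorem le_risk_of_measure_sqDist_lt_le_half [SFinite ν] {c : ENNReal} (hf : IsDensity volume f)
    (hh : IsDensity ν h) (hμ : Measurable μ) (hσ : Measurable σ)
    (hest : Measurable (Function.uncurry est))
    (hhalf : Measure.pi (fun _ : Fin n => obsLaw ν f μ σ h) {z | sqDist ν h μ (est z) < c} ≤ 2⁻¹) :
    c * 2⁻¹ ≤ risk ν f est μ σ h := by
  have := isProbabilityMeasure_obsLaw hf hh hμ hσ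
  have hm := measurable_sqDist_uncurry (ν := ν) hh.measurable hμ hest
  set P := Measure.pi fun _ : Fin n => obsLaw ν f μ σ h
  have hcompl : 2⁻¹ ≤ P {z | sqDist ν h μ (est z) < c}ᶜ := by
    rw [prob_compl_eq_one_sub (measurableSet_lt hm measurable_const), ← ENNReal.one_sub_inv_two]
    gcongr
  calc c * 2⁻¹ ≤ c * P {z | sqDist ν h μ (est z) < c}ᶜ := by gcongr
    _ = c * P {z | c ≤ sqDist ν h μ (est z)} := by simp only [Set.compl_ofPred, not_lt]
    _ ≤ risk ν f est μ σ h := mul_meas_ge_le_lintegral hm c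

theorem le_minimaxRisk_of_isPacking [SFinite ν] {N T : Finset (𝒳 → ℝ)} {δ : ℝ} {D : NNReal}
    (hf : IsDensity volume f) (hUm : ∀ μ ∈ U, Measurable μ) (hσS : σ ∈ S) (hσ : Measurable σ)
    (hhH : h ∈ H) (hh : IsDensity ν h) (hN : IsPacking ν h U δ N) (hT : ∀ v ∈ T, Measurable v)
    (hcov : ∀ u ∈ N, ∃ v ∈ T, n * klDiv (obsLaw ν f u σ h) (obsLaw ν f v σ h) ≤ D)
    (hne : N.Nonempty) (hcard : 4 * Real.exp (4 * (D + 1)) * T.card ≤ N.card) :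
    ENNReal.ofReal (δ ^ 2 / 8) ≤ minimaxRisk ν f U S H n := by
  have hNm : ∀ u ∈ N, Measurable u := fun u hu => hUm u (hN.1 u hu)
  let P : (𝒳 → ℝ) → Measure (Fin n → 𝒳 × ℝ) := fun u => Measure.pi fun _ => obsLaw ν f u σ h
  have hP : ∀ u, Measurable u → IsProbabilityMeasure (P u) := fun u hu => by
    have := isProbabilityMeasure_obsLaw hf hh hu hσ
    infer_instance
  have hPcov : ∀ u ∈ N, ∃ v ∈ T, klDiv (P u) (P v) ≤ D := fun u hu => by
    obtain ⟨v, hv, huv⟩ := hcov u hu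
    have := isProbabilityMeasure_obsLaw hf hh (hNm u hu) hσ
    have := isProbabilityMeasure_obsLaw hf hh (hT v hv) hσ
    refine ⟨v, hv, le_trans (le_of_eq ?_) huv⟩
    simp only [P, klDiv_pi, Finset.sum_const, Finset.card_univ, Fintype.card_fin, nsmul_eq_mul]
  refine le_minimaxRisk_of_forall_exists_le fun est hest => ?_
  obtain ⟨u, hu, hhalf⟩ := exists_measure_le_half_of_klDiv_le (fun u hu => hP u (hNm u hu))
    (fun v hv => hP v (hT v hv))
    (fun u hu => measurableSet_lt (measurable_sqDist_uncurry hh.measurable (hNm u hu) hest)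
      measurable_const)
    (hN.pairwiseDisjoint_ball hh hUm fun z => hest.of_uncurry_left) hPcov hne hcard
  refine ⟨u, hN.1 u hu, σ, hσS, h, hhH, le_trans (le_of_eq ?_)
    (le_risk_of_measure_sqDist_lt_le_half hf hh (hNm u hu) hσ hest hhalf)⟩
  rw [← ENNReal.ofReal_ofNat 2, ← ENNReal.ofReal_inv_of_pos two_pos,
    ← ENNReal.ofReal_mul (by positivity)]
  ring_nf

end LowerBound

section Richness

variable {M : ℝ → ℝ}

theorem Rich.exists_eventually_mul_le (hrich : Rich M) (hM : ∀ᶠ ε in 𝓝[>] (0 : ℝ), 0 ≤ M ε) :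
    ∃ α ρ : ℝ, 0 < α ∧ 1 < ρ ∧ ∀ᶠ ε in 𝓝[>] (0 : ℝ), 0 < M ε ∧ ρ * M ε ≤ M (α * ε) := by
  obtain ⟨α, hα, -, hlim⟩ := hrich
  obtain ⟨ρ, hρ, hρlim⟩ := EReal.lt_iff_exists_real_btwn.1 hlim
  have hρ1 : 1 < ρ := by exact_mod_cast hρ
  refine ⟨α, ρ, hα, hρ1, ?_⟩
  filter_upwards [eventually_lt_of_lt_liminf hρlim, hM] with ε hratio hnonneg
  have hratio : ρ < M (α * ε) / M ε := by exact_mod_cast hratio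
  have hpos : 0 < M ε := hnonneg.lt_of_ne fun h0 => by
    rw [← h0, div_zero] at hratio
    linarith
  exact ⟨hpos, ((lt_div_iff₀ hpos).1 hratio).le⟩

theorem Rich.exists_eventually_const_mul_le (hrich : Rich M)
    (hM : ∀ᶠ ε in 𝓝[>] (0 : ℝ), 0 ≤ M ε) (Λ : ℝ) :
    ∃ c : ℝ, 0 < c ∧ ∀ᶠ ε in 𝓝[>] (0 : ℝ), Λ * M ε ≤ M (c * ε) := by
  obtain ⟨α, ρ, hα, hρ, hev⟩ := hrich.exists_eventually_mul_le hM
  have hgeom : ∀ k : ℕ, ∀ᶠ ε in 𝓝[>] (0 : ℝ), ρ ^ k * M ε ≤ M (α ^ k * ε) := fun k => by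
    induction k with
    | zero => simp
    | succ k ih =>
      filter_upwards [ih, eventually_nhdsGT_zero_mul_left (pow_pos hα k) hev]
        with ε hk hstep
      calc ρ ^ (k + 1) * M ε = ρ * (ρ ^ k * M ε) := by ring
        _ ≤ ρ * M (α ^ k * ε) := by gcongr
        _ ≤ M (α * (α ^ k * ε)) := hstep.2
        _ = M (α ^ (k + 1) * ε) := by rw [pow_succ', mul_assoc]
  obtain ⟨k, hk⟩ := pow_unbounded_of_one_lt Λ hρ
  refine ⟨α ^ k, pow_pos hα k, ?_⟩
  filter_upwards [hgeom k, hM] with ε hle hnonneg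
  exact (mul_le_mul_of_nonneg_right hk.le hnonneg).trans hle

variable {𝒳 : Type*} [MeasurableSpace 𝒳] {ν : Measure 𝒳} {h : 𝒳 → ℝ} {V : Set (𝒳 → ℝ)}

theorem Rich.exists_eventually_const_le (hrich : Rich M)
    (hM : IsEntropyOrder M (packingEntropy ν h V)) :
    ∃ m : ℝ, 0 < m ∧ ∀ᶠ ε in 𝓝[>] (0 : ℝ), m ≤ M ε := by
  obtain ⟨a, b, ha, hb, hent⟩ := hM
  obtain ⟨_, _, _, _, hpos⟩ := hrich.exists_eventually_mul_le (hent.mono fun _ h => h.1)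
  refine ⟨Real.log 2 / b, div_pos (Real.log_pos one_lt_two) hb, ?_⟩
  filter_upwards [hent, hpos] with ε hentε hposε
  obtain ⟨_, hlow, hup⟩ := hentε
  have hpos : 0 < M ε := hposε.1
  obtain ⟨N, hN, hlog⟩ := exists_isPacking_lt_log_card (L := 0) le_rfl
    ((ENNReal.ofReal_lt_ofReal_iff (mul_pos ha hpos)).2 (mul_pos ha hpos) |>.trans_le hlow)
  have htwo : 2 ≤ N.card := by
    by_contra! hlt
    interval_cases N.card <;> simp at hlog
  rw [div_le_iff₀' hb]
  calc Real.log 2 ≤ Real.log N.card := Real.log_le_log two_pos (by exact_mod_cast htwo)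
    _ ≤ b * M ε := hN.log_card_le (by positivity) hup

theorem Rich.exists_eventually_isPacking (hrich : Rich M)
    (hM : IsEntropyOrder M (packingEntropy ν h V)) {Λ : ℝ} (hΛ : 0 ≤ Λ) :
    ∃ c : ℝ, 0 < c ∧ ∀ᶠ ε in 𝓝[>] (0 : ℝ),
      ∃ N, IsPacking ν h V (c * ε) N ∧ Λ * (M ε + 1) < Real.log N.card := by
  obtain ⟨m, hm, hmle⟩ := hrich.exists_eventually_const_le hM
  obtain ⟨a, b, ha, -, hent⟩ := hM
  obtain ⟨c, hc, hgrowth⟩ := hrich.exists_eventually_const_mul_le (hent.mono fun _ h => h.1)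
    ((Λ * (1 + m⁻¹) + 1) / a)
  refine ⟨c, hc, ?_⟩
  filter_upwards [hmle, hgrowth, eventually_nhdsGT_zero_mul_left hc hent]
    with ε hmM hgrow hentε
  have hMpos : 0 < M ε := hm.trans_le hmM
  have hlt : Λ * (M ε + 1) < a * M (c * ε) := by
    have hone : 1 ≤ m⁻¹ * M ε := by rwa [← div_eq_inv_mul, one_le_div hm]
    calc Λ * (M ε + 1) ≤ Λ * (M ε + m⁻¹ * M ε) := by gcongr
      _ < (Λ * (1 + m⁻¹) + 1) * M ε := by linarith
      _ = a * ((Λ * (1 + m⁻¹) + 1) / a * M ε) := by field_simp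
      _ ≤ a * M (c * ε) := by gcongr
  exact exists_isPacking_lt_log_card (by positivity)
    (((ENNReal.ofReal_lt_ofReal_iff_of_nonneg (by positivity)).2 hlt).trans_le hentε.2.1)

end Richness

section Rate

variable {𝒳 : Type*} [MeasurableSpace 𝒳] {ν : Measure 𝒳} {f M : ℝ → ℝ} {U S H : Set (𝒳 → ℝ)}
  {B : Set (ℝ × ℝ)} {K L : NNReal} {h₀ : 𝒳 → ℝ} {ε : ℕ → ℝ}

theorem exists_eventually_minimaxRisk_le {C : ℝ} (hf : IsDensity volume f)
    (hfB : IsComparableOn f B K L) (hUm : ∀ μ ∈ U, Measurable μ) (hSm : ∀ σ ∈ S, Measurable σ)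
    (hH : ∀ h ∈ H, IsDensity ν h) (hB : ∀ μ ∈ U, ∀ σ ∈ S, ∀ x, (μ x, σ x) ∈ B)
    (hh₀ : IsDensity ν h₀) (hdom : ∀ h ∈ H, ∀ x, h x ≤ C * h₀ x)
    (hU : ∃ b : ℝ, ∀ᶠ r in 𝓝[>] (0 : ℝ), packingEntropy ν h₀ U r ≤ ENNReal.ofReal (b * M r))
    (hS : ∃ b : ℝ, ∀ᶠ r in 𝓝[>] (0 : ℝ), packingEntropy ν h₀ S r ≤ ENNReal.ofReal (b * M r))
    (hε : Tendsto ε atTop (𝓝[>] 0)) (hεeq : ∀ᶠ n : ℕ in atTop, M (ε n) = n * ε n ^ 2) :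
    ∃ R : NNReal, ∀ᶠ n : ℕ in atTop,
      minimaxRisk ν f U S H n ≤ R * ENNReal.ofReal (ε n ^ 2) := by
  obtain ⟨b, hb⟩ := hU
  obtain ⟨b', hb'⟩ := hS
  refine ⟨L * (2 * (|b| + |b'|).toNNReal + 2 * (K * C.toNNReal)), ?_⟩
  filter_upwards [eventually_ne_atTop 0, hεeq, hε.eventually hb, hε.eventually hb']
    with n hn hMn hentU hentS
  have hnonneg : 0 ≤ M (ε n) := hMn ▸ by positivity
  obtain ⟨NU, hNU, hcovU, hcardU⟩ := exists_cover_of_packingEntropy_le hnonneg hentU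
  obtain ⟨NS, hNS, hcovS, hcardS⟩ := exists_cover_of_packingEntropy_le hnonneg hentS
  have hlog : ENNReal.ofReal (Real.log NU.card + Real.log NS.card)
      ≤ ENNReal.ofReal (|b| + |b'|) * (n * ENNReal.ofReal (ε n ^ 2)) := by
    rw [← ENNReal.ofReal_natCast, ← ENNReal.ofReal_mul (by positivity),
      ← ENNReal.ofReal_mul (by positivity), ← hMn, add_mul]
    exact ENNReal.ofReal_le_ofReal (add_le_add hcardU hcardS)
  obtain ⟨est, hest, hrisk⟩ := exists_estimator_mul_risk_le_of_cover hf hfB hUm hSm hH hB hh₀ hdom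
    hNU hNS hcovU hcovS n
  refine minimaxRisk_le_of_mul_risk_le hn hest fun μ hμ σ hσ h hh =>
    (hrisk μ hμ σ hσ h hh).trans ?_
  calc _ ≤ L * (2 * (ENNReal.ofReal (|b| + |b'|) * (n * ENNReal.ofReal (ε n ^ 2)))
        + n * (K * (ENNReal.ofReal C * ENNReal.ofReal (ε n ^ 2)
          + ENNReal.ofReal C * ENNReal.ofReal (ε n ^ 2)))) := by gcongr
    _ = n * ((L * (2 * (|b| + |b'|).toNNReal + 2 * (K * C.toNNReal)) : NNReal)
        * ENNReal.ofReal (ε n ^ 2)) := by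
      simp only [ENNReal.ofReal]
      push_cast
      ring

theorem klDiv_obsLaw_le {u v σ h : 𝒳 → ℝ} (hf : IsDensity volume f)
    (hfB : IsComparableOn f B K L) (hh : IsDensity ν h) (hu : Measurable u) (hv : Measurable v)
    (hσ : Measurable σ) (huB : ∀ x, (u x, σ x) ∈ B) (hvB : ∀ x, (v x, σ x) ∈ B) :
    klDiv (obsLaw ν f u σ h) (obsLaw ν f v σ h) ≤ K * sqDist ν h u v := by
  have hupos : ∀ x, 0 < (u x, σ x).2 := fun x => hfB.snd_pos (huB x)
  have hvpos : ∀ x, 0 < (v x, σ x).2 := fun x => hfB.snd_pos (hvB x)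
  have hle := klDiv_condDensity_le hf hh (hu.prodMk hσ) (hv.prodMk hσ) hupos hvpos
    fun x => hfB.klDiv_le (huB x) (hvB x)
  rwa [sqDist_self, add_zero, ← obsLaw_eq_densityMeasure hf (hu.prodMk hσ) hupos,
    ← obsLaw_eq_densityMeasure hf (hv.prodMk hσ) hvpos] at hle

theorem four_mul_exp_mul_le_of_lt_log {k b m : ℝ} {t N : ℕ} (hk : 0 ≤ k) (hb : 0 ≤ b) (hm : 0 ≤ m)
    (hN : 0 < N) (ht : Real.log t ≤ b * m)
    (hlogN : (Real.log 4 + 4 * k + 4 + b) * (m + 1) < Real.log N) :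
    4 * Real.exp (4 * (k * m + 1)) * t ≤ N := by
  have hlog4 : 0 ≤ Real.log 4 := Real.log_nonneg (by norm_num)
  calc 4 * Real.exp (4 * (k * m + 1)) * t
      ≤ Real.exp (Real.log 4) * Real.exp (4 * (k * m + 1)) * Real.exp (b * m) := by
        gcongr
        · exact Real.le_exp_log 4
        · exact (Real.le_exp_log _).trans (Real.exp_le_exp.2 ht)
    _ ≤ Real.exp ((Real.log 4 + 4 * k + 4 + b) * (m + 1)) := by
        rw [← Real.exp_add, ← Real.exp_add, Real.exp_le_exp]
        nlinarith [mul_nonneg hlog4 hm]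
    _ ≤ N := ((Real.lt_log_iff_exp_lt (by exact_mod_cast hN)).1 hlogN).le

theorem exists_eventually_le_minimaxRisk [SFinite ν] {σ : 𝒳 → ℝ} (hf : IsDensity volume f)
    (hfB : IsComparableOn f B K L) (hUm : ∀ μ ∈ U, Measurable μ) (hσS : σ ∈ S)
    (hσ : Measurable σ) (hB : ∀ μ ∈ U, ∀ x, (μ x, σ x) ∈ B) (hh₀H : h₀ ∈ H)
    (hh₀ : IsDensity ν h₀) (hM : IsEntropyOrder M (packingEntropy ν h₀ U)) (hrich : Rich M)
    (hε : Tendsto ε atTop (𝓝[>] 0)) (hεeq : ∀ᶠ n : ℕ in atTop, M (ε n) = n * ε n ^ 2) :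
    ∃ c : ℝ, 0 < c ∧ ∀ᶠ n : ℕ in atTop,
      ENNReal.ofReal (c * ε n ^ 2) ≤ minimaxRisk ν f U S H n := by
  obtain ⟨_, b, _, _, hent⟩ := id hM
  have : 0 ≤ Real.log 4 := Real.log_nonneg (by norm_num)
  obtain ⟨c, hc, hpack⟩ := hrich.exists_eventually_isPacking hM
    (Λ := Real.log 4 + 4 * K + 4 + |b|) (by positivity)
  refine ⟨c ^ 2 / 8, by positivity, ?_⟩
  filter_upwards [hεeq, hε.eventually hent, hε.eventually hpack] with n hMn hentn hpackn
  obtain ⟨hMnonneg, -, hentU⟩ := hentn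
  obtain ⟨N, hN, hlogN⟩ := hpackn
  obtain ⟨T, hTU, hcov, hcardT⟩ := exists_cover_of_packingEntropy_le hMnonneg hentU
  have hNpos : 0 < N.card := Nat.pos_of_ne_zero fun h0 => by
    rw [h0, Nat.cast_zero, Real.log_zero] at hlogN
    exact absurd hlogN (not_lt.2 (by positivity))
  have hcard : 4 * Real.exp (4 * (↑(K * (M (ε n)).toNNReal) + 1)) * T.card ≤ N.card := by
    rw [NNReal.coe_mul, Real.coe_toNNReal _ hMnonneg]
    exact four_mul_exp_mul_le_of_lt_log K.coe_nonneg (abs_nonneg b) hMnonneg hNpos hcardT hlogN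
  have hKL : ∀ u ∈ N, ∃ v ∈ T, n * klDiv (obsLaw ν f u σ h₀)
      (obsLaw ν f v σ h₀) ≤ (K * (M (ε n)).toNNReal : NNReal) := fun u hu => by
    obtain ⟨v, hv, huv⟩ := hcov u (hN.1 u hu)
    refine ⟨v, hv, ?_⟩
    calc n * klDiv (obsLaw ν f u σ h₀) (obsLaw ν f v σ h₀)
        ≤ n * (K * ENNReal.ofReal (ε n ^ 2)) := by
          grw [klDiv_obsLaw_le hf hfB hh₀ (hUm u (hN.1 u hu)) (hUm v (hTU v hv)) hσ
            (hB u (hN.1 u hu)) (hB v (hTU v hv)), huv]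
      _ = (K * (M (ε n)).toNNReal : NNReal) := by
          rw [mul_left_comm, ← ENNReal.ofReal_natCast, ← ENNReal.ofReal_mul (by positivity), ← hMn,
            ENNReal.coe_mul]
          rfl
  refine le_trans (le_of_eq ?_) (le_minimaxRisk_of_isPacking hf hUm hσS hσ hh₀H hh₀ hN
    (fun v hv => hUm v (hTU v hv)) hKL (Finset.card_pos.1 hNpos) hcard)
  ring_nf

end Rate

end LocScale

theorem theorem1_general {𝒳 : Type*} [MeasurableSpace 𝒳] (ν : Measure 𝒳) [SFinite ν]
    (f : ℝ → ℝ) (hf : LocScale.IsDensity volume f)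
    (U : Set (𝒳 → ℝ)) (hUmeas : ∀ μ ∈ U, Measurable μ)
    (J : ℝ) (hUbdd : ∀ μ ∈ U, ∀ x, |μ x| ≤ J)
    (S : Set (𝒳 → ℝ)) (hSne : S.Nonempty) (hSmeas : ∀ σ ∈ S, Measurable σ)
    (σbar : ℝ) (hσbar : 0 < σbar) (hSbdd : ∀ σ ∈ S, ∀ x, σbar⁻¹ ≤ σ x ∧ σ x ≤ σbar)
    (H : Set (𝒳 → ℝ)) (hH : ∀ h ∈ H, LocScale.IsDensity ν h)
    (hKL : LocScale.KLFiniteContinuous f)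
    (hKLlocal : LocScale.KLLocallyQuadratic f)
    (hHellinger : LocScale.HellingerNondegenerate f)
    (h₀ : 𝒳 → ℝ) (hh₀ : h₀ ∈ H) (C : ℝ) (hdom : ∀ h ∈ H, ∀ x, h x ≤ C * h₀ x)
    (M : ℝ → ℝ) (hM : LocScale.IsEntropyOrder M (LocScale.packingEntropy ν h₀ U))
    (hrich : LocScale.Rich M)
    (hS : ∃ B : ℝ, ∀ᶠ ε in 𝓝[>] (0 : ℝ),
      LocScale.packingEntropy ν h₀ S ε ≤ ENNReal.ofReal (B * M ε))
    (ε : ℕ → ℝ) (hεpos : ∀ᶠ n in atTop, 0 < ε n) (hεlim : Tendsto ε atTop (𝓝 0))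
    (hεeq : ∀ᶠ n : ℕ in atTop, M (ε n) = n * ε n ^ 2) :
    ∃ c₁ c₂ : ℝ, 0 < c₁ ∧ 0 < c₂ ∧ ∀ᶠ n : ℕ in atTop,
      ENNReal.ofReal (c₁ * ε n ^ 2) ≤ LocScale.minimaxRisk ν f U S H n ∧
      LocScale.minimaxRisk ν f U S H n ≤ ENNReal.ofReal (c₂ * ε n ^ 2) := by
  obtain ⟨K, L, hcomp⟩ :=
    LocScale.exists_isComparableOn_paramBox hf hKL hKLlocal hHellinger J hσbar
  have hbox : ∀ μ ∈ U, ∀ σ ∈ S, ∀ x, (μ x, σ x) ∈ LocScale.paramBox J σbar :=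
    fun μ hμ σ hσ x => ⟨abs_le.1 (hUbdd μ hμ x), hSbdd σ hσ x⟩
  have hε : Tendsto ε atTop (𝓝[>] 0) := tendsto_nhdsWithin_iff.2 ⟨hεlim, hεpos⟩
  have hU : ∃ b : ℝ, ∀ᶠ r in 𝓝[>] (0 : ℝ),
      LocScale.packingEntropy ν h₀ U r ≤ ENNReal.ofReal (b * M r) := by
    obtain ⟨_, b, _, _, hent⟩ := hM
    exact ⟨b, hent.mono fun _ h => h.2.2⟩
  obtain ⟨σ, hσ⟩ := hSne
  obtain ⟨c, hc, hlower⟩ := LocScale.exists_eventually_le_minimaxRisk hf hcomp hUmeas hσ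
    (hSmeas σ hσ) (fun μ hμ => hbox μ hμ σ hσ) hh₀ (hH h₀ hh₀) hM hrich hε hεeq
  obtain ⟨R, hupper⟩ := LocScale.exists_eventually_minimaxRisk_le hf hcomp hUmeas hSmeas hH hbox
    (hH h₀ hh₀) hdom hU hS hε hεeq
  refine ⟨c, R + 1, hc, by positivity, hlower.and (hupper.mono fun n hn => hn.trans ?_)⟩
  rw [← ENNReal.ofReal_coe_nnreal, ← ENNReal.ofReal_mul R.coe_nonneg]
  gcongr
  exact le_add_of_nonneg_right zero_le_one

theorem theorem1 {𝒳 : Type*} [MeasurableSpace 𝒳] (ν : Measure 𝒳) [SigmaFinite ν]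
    (f : ℝ → ℝ) (hf : LocScale.IsDensity volume f)
    -- the regression functions: measurable and uniformly bounded
    (U : Set (𝒳 → ℝ)) (hUmeas : ∀ μ ∈ U, Measurable μ)
    (J : ℝ) (hUbdd : ∀ μ ∈ U, ∀ x, |μ x| ≤ J)
    -- the scale functions: measurable and bounded away from zero and infinity
    (S : Set (𝒳 → ℝ)) (hSne : S.Nonempty) (hSmeas : ∀ σ ∈ S, Measurable σ)
    (σbar : ℝ) (hσbar : 1 < σbar) (hSbdd : ∀ σ ∈ S, ∀ x, σbar⁻¹ ≤ σ x ∧ σ x ≤ σbar)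
    -- the design densities
    (H : Set (𝒳 → ℝ)) (hH : ∀ h ∈ H, LocScale.IsDensity ν h)
    -- the conditions on the error density
    (hKL : LocScale.KLFiniteContinuous f)
    (hKLlocal : LocScale.KLLocallyQuadratic f)
    (hHellinger : LocScale.HellingerNondegenerate f)
    -- the dominating design density
    (h₀ : 𝒳 → ℝ) (hh₀ : h₀ ∈ H) (C : ℝ) (hdom : ∀ h ∈ H, ∀ x, h x ≤ C * h₀ x)
    -- the metric entropy: `M` is the order of the entropy of `U`
    (M : ℝ → ℝ) (hM : LocScale.IsEntropyOrder M (LocScale.packingEntropy ν h₀ U))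
    (hrich : LocScale.Rich M) (hreg : LocScale.OrderRegular M)
    (hS : ∃ B : ℝ, ∀ᶠ ε in 𝓝[>] (0 : ℝ),
      LocScale.packingEntropy ν h₀ S ε ≤ ENNReal.ofReal (B * M ε))
    -- the solution of `M(ε_n) = n ε_n²` near zero
    (ε : ℕ → ℝ) (hεpos : ∀ᶠ n in atTop, 0 < ε n) (hεlim : Tendsto ε atTop (𝓝 0))
    (hεeq : ∀ᶠ n : ℕ in atTop, M (ε n) = n * ε n ^ 2) :
    ∃ c₁ c₂ : ℝ, 0 < c₁ ∧ 0 < c₂ ∧ ∀ᶠ n : ℕ in atTop,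
      ENNReal.ofReal (c₁ * ε n ^ 2) ≤ LocScale.minimaxRisk ν f U S H n ∧
      LocScale.minimaxRisk ν f U S H n ≤ ENNReal.ofReal (c₂ * ε n ^ 2) :=
  theorem1_general ν f hf U hUmeas J hUbdd S hSne hSmeas σbar (one_pos.trans hσbar) hSbdd H hH hKL
    hKLlocal hHellinger h₀ hh₀ C hdom M hM hrich hS ε hεpos hεlim hεeq
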